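/- Conventions: all structures are finite and nonempty; all vocabularies are finite and contain relation symbols and individual constants but no function symbols of positive arity; classes of structures are closed under isomorphism. $L^{\omega}_{\infty\omega}$ is the logic whose formulas are built from atomic formulas (including equalities) by negation, existential and universal quantification over individual variables, and conjunctions and disjunctions of arbitrary (possibly infinite) families of formulas, subject to the requirement that only finitely many individual variables, free or bound, occur in the whole formula. If $M$ is a structure and $X\subseteq |M|$ is nonempty and contains the interpretations of all constants, $M\mid X$ denotes the induced substructure with universe $X$. Theorem. Let $K_1$ be a class of structures of some vocabulary $\tau_1$, let $\tau_2=\tau_1\cup\{P\}$ be the extension of $\tau_1$ by an additional binary predicate symbol $P$, and let $\mathcal L$ be an arbitrary countable set of $L^{\omega}_{\infty\omega}$-formulas of vocabulary $\tau_2$. Then there exists a class $K_2$ of $\tau_2$-structures such that: 1. for every $M_2\in K_2$ the set $\{x\mid M_2\models P(x,x)\}$ is the universe of a substructure of $M_2$, and $K_1$ is precisely the class of structures that are (isomorphic to) $\tau_1$-reducts of the substructures $M_2\mid\{x\mid P(x,x)\}$, where $M_2$ ranges over $K_2$; 2. every formula $\varphi\in\mathcal L$ is equivalent in $K_2$ to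 a first-order $\tau_2$-formula $\psi$, i.e. $\varphi$ and $\psi$ have the same truth value in every $M_2\in K_2$ under every assignment of elements of $M_2$ to the variables. -/

import Mathlib

open FirstOrder
open CategoryTheory (Bundled)

universe u v w i

namespace McColm


/-- A vocabulary: finitely many symbols, and no function symbols of positive arity
(individual constants are allowed). -/
structure IsVocabulary (L : FirstOrder.Language.{u, v}) : Prop where
  finite_symbols : Finite L.Symbols
  no_functions : ∀ n : ℕ, 0 < n → IsEmpty (L.Functions n)

/-- The symbols of the vocabulary `{P}`, where `P` is a binary predicate. -/
inductive PRel : ℕ → Type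
  | P : PRel 2

/-- The vocabulary `{P}`. -/
def langP : FirstOrder.Language.{0, 0} := ⟨fun _ => Empty, PRel⟩

/-- The vocabulary `L ∪ {P}`, where `P` is an additional binary predicate. -/
abbrev addP (L : FirstOrder.Language.{u, v}) : FirstOrder.Language.{u, v} := L.sum langP

/-- The set `{x | P(x, x)}` in an `L ∪ {P}`-structure `M`. -/
def diagP (L : FirstOrder.Language.{u, v}) (M : Type w) [(addP L).Structure M] : Set M :=
  {x | FirstOrder.Language.Structure.RelMap (L := addP L) (Sum.inr PRel.P : (addP L).Relations 2) ![x, x]}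

/-- A class of structures: all members are finite and nonempty, and the class is closed under
isomorphism. -/
structure IsClass {L : FirstOrder.Language.{u, v}} (K : Set (Bundled.{w} L.Structure)) : Prop where
  finite : ∀ M ∈ K, Finite M
  nonempty : ∀ M ∈ K, Nonempty M
  closed_under_iso : ∀ M ∈ K, ∀ N : Bundled.{w} L.Structure, Nonempty (M ≃[L] N) → N ∈ K

/-- The `L`-reduct of a substructure of an `L ∪ {P}`-structure. -/
def reductOf {L : FirstOrder.Language.{u, v}} {M : Bundled.{w} (addP L).Structure}
    (S : (addP L).Substructure M) : Bundled.{w} L.Structure :=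
  ⟨S, (FirstOrder.Language.LHom.sumInl : L →ᴸ addP L).reduct S⟩

/-- Formulas of `L_{∞ω}`, with individual variables indexed by `ℕ`: conjunctions and disjunctions
of arbitrary families are allowed. -/
inductive InfFormula (L : FirstOrder.Language.{u, v}) : Type (max u v (i + 1))
  | equal (t₁ t₂ : L.Term ℕ) : InfFormula L
  | rel {n : ℕ} (R : L.Relations n) (ts : Fin n → L.Term ℕ) : InfFormula L
  | neg (φ : InfFormula L) : InfFormula L
  | ex (x : ℕ) (φ : InfFormula L) : InfFormula L
  | all (x : ℕ) (φ : InfFormula L) : InfFormula L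
  | disj {I : Type i} (φ : I → InfFormula L) : InfFormula L
  | conj {I : Type i} (φ : I → InfFormula L) : InfFormula L

namespace InfFormula

variable {L : FirstOrder.Language.{u, v}}

/-- The individual variables, bound or free, that occur in a formula. -/
def vars : InfFormula.{u, v, i} L → Set ℕ
  | equal t₁ t₂ => ↑t₁.varFinset ∪ ↑t₂.varFinset
  | rel _ ts => ⋃ j, ↑(ts j).varFinset
  | neg φ => φ.vars
  | ex x φ => {x} ∪ φ.vars
  | all x φ => {x} ∪ φ.vars
  | disj φ => ⋃ j, (φ j).vars
  | conj φ => ⋃ j, (φ j).vars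

/-- Truth of a formula in a structure, under an assignment of elements to the variables. -/
def Realize {M : Type w} [L.Structure M] : InfFormula.{u, v, i} L → (ℕ → M) → Prop
  | equal t₁ t₂, a => t₁.realize a = t₂.realize a
  | rel R ts, a => FirstOrder.Language.Structure.RelMap R fun j => (ts j).realize a
  | neg φ, a => ¬ φ.Realize a
  | ex x φ, a => ∃ b : M, φ.Realize (Function.update a x b)
  | all x φ, a => ∀ b : M, φ.Realize (Function.update a x b)
  | disj φ, a => ∃ j, (φ j).Realize a
  | conj φ, a => ∀ j, (φ j).Realize a

/-- `φ` is equivalent to the first-order formula `ψ` in the class `K`: they have the same truth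
value in every structure of `K` under every assignment. -/
def EquivIn (K : Set (Bundled.{w} L.Structure)) (φ : InfFormula.{u, v, i} L)
    (ψ : L.Formula ℕ) : Prop :=
  ∀ M ∈ K, ∀ a : ℕ → M, φ.Realize a ↔ ψ.Realize a

end InfFormula

/-- The logic `L^ω_{∞ω}`: formulas of `L_{∞ω}` in which only finitely many individual variables,
bound or free, occur. -/
def finVarLogic (L : FirstOrder.Language.{u, v}) : Set (InfFormula.{u, v, i} L) :=
  {φ | φ.vars.Finite}

end McColm

open McColm

/-! Up to isomorphism `K₁` is a sequence of finite structures `f n`, and the given formulas form a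
sequence of tasks `r i`. It is enough to extend each `f n` to a finite structure `N n` whose set of
loops is `f n`, in such a way that for every `i < n` the `i`-th formula is equivalent in `N n` to a
first-order formula that does not depend on `n`. The class `K₂` is the closure of the `N n` under
isomorphism. The `i`-th formula then escapes control only in the finitely many `N n` with `n ≤ i`,
and these are absorbed because finite structures are first-order definable up to isomorphism
(`exists_formula_union`).

The extensions rest on genericity. In a finite random-like `P`-extension of a base `B`, a
back-and-forth argument shows that the truth of a formula with `k` variables depends only on the
atomic `P`-type of the tuple over `B` (`Sim.realize_iff`). Such extensions exist by counting
(`exists_gen`), even if the traces of the outer elements on `B` are confined to a prescribed set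
`C`.

An atomic type over `B` can be written as finitely many traces (`Codes`, `exists_codes`). For each
code that is realized by a tuple satisfying the formula, a transitive tournament of size `K` whose
vertices carry these traces is attached to `B`. Later elements must omit, that is, be unconnected
with, some vertex of each of these tournaments. In a generic extension under this restriction the
attached tournaments are exactly the maximal ones of size `K` outside `B` (`maxTour_iff`), so a
first-order formula finds them and reads the truth of the given formula off them
(`realize_iff_exists_maxTour`). Fewer than `K` elements cannot cover a tournament, so the result is
still generic over `B` for fewer than `K` outer elements (`Gen.old`). Hence the step can be iterated
with growing sizes `K`, each stage being definable from the one before (`Stage.iter_spec`). -/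

namespace McColm

/-! ### Generic extensions and the back-and-forth argument. -/

section Generic

variable (L : FirstOrder.Language.{u, v})

/-- The relation `P` of an `L ∪ {P}`-structure. -/
def Edge {N : Type w} [(addP L).Structure N] (x y : N) : Prop :=
  FirstOrder.Language.Structure.RelMap (L := addP L)
    (Sum.inr PRel.P : (addP L).Relations 2) ![x, y]

/-- How two elements are connected by `P`, in both directions. -/
def edgeType {N : Type w} [(addP L).Structure N] (x y : N) : Prop × Prop :=
  (Edge L x y, Edge L y x)

/-- How an element is connected by `P` with the image of `j`. -/
def trace {B N : Type w} [(addP L).Structure N] (j : B → N) (x : N) : B → Prop × Prop :=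
  fun b => edgeType L (j b) x

/-- `j` embeds `B` into `N` so that constants, the relations other than `P`, and the loops of `P`
live in the image of `j`. -/
structure PureEmb {B N : Type w} [(addP L).Structure B] [(addP L).Structure N] (j : B → N) :
    Prop where
  inj : Function.Injective j
  edge : ∀ b b', Edge L (j b) (j b') ↔ Edge L b b'
  rel : ∀ {n : ℕ} (R : L.Relations n) (xs : Fin n → N),
    FirstOrder.Language.Structure.RelMap (L := addP L) (Sum.inl R : (addP L).Relations n) xs ↔
      ∃ ys : Fin n → B, (fun i => j (ys i)) = xs ∧
        FirstOrder.Language.Structure.RelMap (L := addP L) (Sum.inl R : (addP L).Relations n) ys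
  const : ∀ (f : (addP L).Functions 0) (xs : Fin 0 → B) (ys : Fin 0 → N),
    FirstOrder.Language.Structure.funMap f ys = j (FirstOrder.Language.Structure.funMap f xs)
  loopless : ∀ x ∉ Set.range j, ¬ Edge L x x

/-- `N` is a generic extension of `B`: outer elements have traces in `C`, and every way to connect
a new element with fewer than `κ` outer elements is realized with every trace in `C`. -/
structure Gen {B N : Type w} [(addP L).Structure B] [(addP L).Structure N]
    (C : Set (B → Prop × Prop)) (κ : ℕ) (j : B → N) : Prop extends PureEmb L j where
  trace_mem : ∀ x ∉ Set.range j, trace L j x ∈ C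
  ext : ∀ S : Finset N, (∀ s ∈ S, s ∉ Set.range j) → S.card < κ → ∀ c ∈ C,
    ∀ p : N → Prop × Prop, ∃ d ∉ Set.range j, d ∉ S ∧ trace L j d = c ∧
      ∀ s ∈ S, edgeType L s d = p s

variable {L}

theorem Gen.mono {B N : Type w} [(addP L).Structure B] [(addP L).Structure N]
    {C : Set (B → Prop × Prop)} {κ κ' : ℕ} {j : B → N} (h : Gen L C κ j) (hκ : κ' ≤ κ) :
    Gen L C κ' j :=
  { h with ext := fun S hS hc => h.ext S hS (hc.trans_le hκ) }

/-- The first `k` values of an assignment together with all elements of `B`. -/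
def val {B N : Type w} (k : ℕ) (j : B → N) (a : ℕ → N) : Fin k ⊕ B → N :=
  Sum.elim (fun l => a l) j

variable (L) in
/-- Two assignments have the same atomic `P`-type over `B`. -/
def Sim {B N N' : Type w} [(addP L).Structure N] [(addP L).Structure N'] (k : ℕ)
    (j : B → N) (j' : B → N') (a : ℕ → N) (a' : ℕ → N') : Prop :=
  ∀ u v : Fin k ⊕ B, (val k j a u = val k j a v ↔ val k j' a' u = val k j' a' v) ∧
    (Edge L (val k j a u) (val k j a v) ↔ Edge L (val k j' a' u) (val k j' a' v))

theorem Sim.symm {B N N' : Type w} [(addP L).Structure N] [(addP L).Structure N'] {k : ℕ}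
    {j : B → N} {j' : B → N'} {a : ℕ → N} {a' : ℕ → N'} (h : Sim L k j j' a a') :
    Sim L k j' j a' a :=
  fun u v => ⟨(h u v).1.symm, (h u v).2.symm⟩

theorem Sim.update {B N N' : Type w} [(addP L).Structure N] [(addP L).Structure N'] {k : ℕ}
    {j : B → N} {j' : B → N'} {a : ℕ → N} {a' : ℕ → N'} (h : Sim L k j j' a a')
    (x : Fin k) {d : N} {d' : N'} (hdd : Edge L d d ↔ Edge L d' d')
    (hd : ∀ u : Fin k ⊕ B, u ≠ Sum.inl x → (val k j a u = d ↔ val k j' a' u = d') ∧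
      edgeType L (val k j a u) d = edgeType L (val k j' a' u) d') :
    Sim L k j j' (Function.update a x d) (Function.update a' x d') := by
  classical
  have key : ∀ {M : Type w} (i : B → M) (b : ℕ → M) (e : M) (u : Fin k ⊕ B),
      val k i (Function.update b x e) u = if u = Sum.inl x then e else val k i b u := by
    intro M i b e u
    rcases u with l | u
    · by_cases hl : l = x
      · subst hl; simp [val]
      · have : (l : ℕ) ≠ x := fun h => hl (Fin.ext h)
        simp [val, hl, this]
    · simp [val]
  intro u v
  rw [key, key, key, key]
  by_cases hu : u = Sum.inl x <;> by_cases hv : v = Sum.inl x <;> simp only [hu, hv, if_true,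
    if_false]
  · simpa using hdd
  · obtain ⟨h1, h2⟩ := hd v hv
    simp only [edgeType, Prod.mk.injEq, eq_iff_iff] at h2
    exact ⟨by rw [eq_comm, h1, eq_comm (a := d')], h2.2⟩
  · obtain ⟨h1, h2⟩ := hd u hu
    simp only [edgeType, Prod.mk.injEq, eq_iff_iff] at h2
    exact ⟨h1, h2.1⟩
  · exact h u v

/-- The back-and-forth step. When one of `k` variables is moved, at most `k - 1` outer elements
remain to be respected, which is why genericity for fewer than `k` elements suffices. -/
theorem Sim.exists_update {B N N' : Type w} [(addP L).Structure B] [(addP L).Structure N]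
    [(addP L).Structure N'] {C : Set (B → Prop × Prop)} {k : ℕ}
    {j : B → N} {j' : B → N'} (hj : Gen L C k j) (hj' : Gen L C k j') {a : ℕ → N} {a' : ℕ → N'}
    (h : Sim L k j j' a a') (x : Fin k) (d : N) :
    ∃ d', Sim L k j j' (Function.update a x d) (Function.update a' x d') := by
  classical
  -- If `d` is already named by a base element or another variable, the answer is the element with
  -- the same name; otherwise `d` is outer and genericity supplies the answer.
  by_cases hu : ∃ u : Fin k ⊕ B, u ≠ Sum.inl x ∧ val k j a u = d
  · obtain ⟨u, -, rfl⟩ := hu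
    refine ⟨val k j' a' u, h.update x (h u u).2 fun v _ => ⟨(h v u).1, ?_⟩⟩
    simp only [edgeType, Prod.mk.injEq, eq_iff_iff]
    exact ⟨(h v u).2, (h u v).2⟩
  · push Not at hu
    have hd : d ∉ Set.range j := by
      rintro ⟨b, rfl⟩
      exact hu (Sum.inr b) (by simp) rfl
    let I : Finset (Fin k) := (Finset.univ.erase x).filter fun l => a' l ∉ Set.range j'
    -- Several variables may name `s`; the choice is harmless because `Sim` makes them name the same
    -- element of `N`.
    let p : N' → Prop × Prop := fun s =>
      if hs : ∃ l : Fin k, a' l = s then edgeType L (a hs.choose) d else (True, True)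
    have hI : (I.image fun l : Fin k => a' l).card < k := by
      refine Finset.card_image_le.trans_lt ((Finset.card_filter_le _ _).trans_lt ?_)
      rw [Finset.card_erase_of_mem (Finset.mem_univ _), Finset.card_univ, Fintype.card_fin]
      have := x.2
      omega
    obtain ⟨d', hd', hdS, htr, hp⟩ := hj'.ext (I.image fun l : Fin k => a' l)
      (by
        intro s hs
        obtain ⟨l, hl, rfl⟩ := Finset.mem_image.1 hs
        exact (Finset.mem_filter.1 hl).2) hI (trace L j d) (hj.trace_mem d hd) p
    have hB : ∀ b, (j b = d ↔ j' b = d') ∧ edgeType L (j b) d = edgeType L (j' b) d' := by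
      intro b
      refine ⟨iff_of_false (fun h => hd ⟨b, h⟩) fun h => hd' ⟨b, h⟩, ?_⟩
      exact (congrFun htr b).symm
    refine ⟨d', h.update x (iff_of_false (hj.loopless d hd) (hj'.loopless d' hd')) ?_⟩
    rintro (l | b) hne
    · by_cases hl : a' l ∈ Set.range j'
      · obtain ⟨b, hb⟩ := hl
        have hb' : a l = j b := (h (Sum.inl l) (Sum.inr b)).1.2 hb.symm
        simp only [val, Sum.elim_inl, hb', ← hb]
        exact hB b
      · have hlx : l ≠ x := fun e => hne (by rw [e])
        have hmem : a' l ∈ I.image fun l : Fin k => a' l :=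
          Finset.mem_image_of_mem (fun l : Fin k => a' l) 
            (Finset.mem_filter.2 ⟨Finset.mem_erase.2 ⟨hlx, Finset.mem_univ _⟩, hl⟩)
        refine ⟨iff_of_false (hu _ hne) ?_, ?_⟩
        · rintro rfl
          exact hdS hmem
        · have hex : ∃ m : Fin k, a' m = a' l := ⟨l, rfl⟩
          have h1 := hp _ hmem
          simp only [p, hex, dif_pos] at h1
          have h2 : a hex.choose = a l :=
            (h (Sum.inl hex.choose) (Sum.inl l)).1.2 hex.choose_spec
          rw [h2] at h1
          exact h1.symm
    · exact hB b

theorem langP_relation {n : ℕ} (R : langP.Relations n) : ∃ h : n = 2, R = h ▸ PRel.P := by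
  have R' : PRel n := R
  obtain ⟨rfl, h⟩ : ∃ h : n = 2, R' = h ▸ PRel.P := by cases R'; exact ⟨rfl, rfl⟩
  refine ⟨rfl, ?_⟩
  have : ∀ Q : PRel 2, Q = PRel.P := by rintro ⟨⟩; rfl
  exact this R

theorem term_cases (hL : IsVocabulary L) {α : Type*} (t : (addP L).Term α) :
    (∃ x, t = FirstOrder.Language.Term.var x) ∨
      ∃ (f : (addP L).Functions 0) (ts : _), t = FirstOrder.Language.Term.func f ts := by
  rcases t with x | ⟨f, ts⟩
  · exact Or.inl ⟨x, rfl⟩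
  · rename_i n
    rcases n with _ | n
    · exact Or.inr ⟨f, ts, rfl⟩
    · rcases f with f | f
      · exact ((hL.no_functions _ n.succ_pos).false f).elim
      · exact f.elim

theorem exists_val (hL : IsVocabulary L) {B N N' : Type w} [(addP L).Structure B]
    [(addP L).Structure N] [(addP L).Structure N'] {k : ℕ}
    {j : B → N} {j' : B → N'} (hj : PureEmb L j) (hj' : PureEmb L j') (a : ℕ → N) (a' : ℕ → N')
    (t : (addP L).Term ℕ) (ht : ∀ x ∈ t.varFinset, x < k) :
    ∃ u : Fin k ⊕ B, t.realize a = val k j a u ∧ t.realize a' = val k j' a' u := by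
  rcases term_cases hL t with ⟨x, rfl⟩ | ⟨f, ts, rfl⟩
  · exact ⟨Sum.inl ⟨x, ht x (by simp [FirstOrder.Language.Term.varFinset])⟩, rfl, rfl⟩
  · exact ⟨Sum.inr (FirstOrder.Language.Structure.funMap f Fin.elim0), hj.const f _ _,
      hj'.const f _ _⟩

/-- Relations other than `P` hold only for tuples from the base, and equality with base elements is
part of `Sim`; this is why `Sim` need not mention these relations. -/
theorem Sim.relMap {B N N' : Type w} [(addP L).Structure B]
    [(addP L).Structure N] [(addP L).Structure N'] {k : ℕ}
    {j : B → N} {j' : B → N'} (hj : PureEmb L j) (hj' : PureEmb L j') {a : ℕ → N} {a' : ℕ → N'}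
    (h : Sim L k j j' a a') {n : ℕ} (R : L.Relations n) (us : Fin n → Fin k ⊕ B)
    (hR : FirstOrder.Language.Structure.RelMap (L := addP L) (Sum.inl R : (addP L).Relations n)
      fun i => val k j a (us i)) :
    FirstOrder.Language.Structure.RelMap (L := addP L) (Sum.inl R : (addP L).Relations n)
      fun i => val k j' a' (us i) := by
  obtain ⟨ys, hys, hR⟩ := (hj.rel R _).1 hR
  refine (hj'.rel R _).2 ⟨ys, funext fun i => ?_, hR⟩
  exact (h (Sum.inr (ys i)) (us i)).1.1 (congrFun hys i)

/-- In generic extensions of the same structure, the truth of a formula with `k` variables depends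
only on the atomic `P`-type over the base. -/
theorem Sim.realize_iff (hL : IsVocabulary L) {B N N' : Type w} [(addP L).Structure B]
    [(addP L).Structure N] [(addP L).Structure N'] {C : Set (B → Prop × Prop)} {k : ℕ}
    {j : B → N} {j' : B → N'} (hj : Gen L C k j) (hj' : Gen L C k j')
    (φ : InfFormula.{u, v, i} (addP L)) :
    (∀ x ∈ φ.vars, x < k) → ∀ {a : ℕ → N} {a' : ℕ → N'}, Sim L k j j' a a' →
      (φ.Realize a ↔ φ.Realize a') := by
  induction φ with
  | equal t₁ t₂ =>
    intro hk a a' h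
    obtain ⟨u₁, e₁, e₁'⟩ := exists_val hL hj.toPureEmb hj'.toPureEmb a a' t₁
      fun x hx => hk x (Or.inl hx)
    obtain ⟨u₂, e₂, e₂'⟩ := exists_val hL hj.toPureEmb hj'.toPureEmb a a' t₂
      fun x hx => hk x (Or.inr hx)
    simp only [InfFormula.Realize, e₁, e₁', e₂, e₂']
    exact (h u₁ u₂).1
  | @rel n R ts =>
    intro hk a a' h
    choose us e e' using fun i => exists_val (k := k) hL hj.toPureEmb hj'.toPureEmb a a' (ts i)
      fun x hx => hk x (Set.mem_iUnion.2 ⟨i, hx⟩)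
    simp only [InfFormula.Realize, e, e']
    rcases R with R | R
    · exact ⟨h.relMap hj.toPureEmb hj'.toPureEmb R us,
        h.symm.relMap hj'.toPureEmb hj.toPureEmb R us⟩
    · obtain ⟨rfl, rfl⟩ := langP_relation R
      have := (h (us 0) (us 1)).2
      simp only [Edge] at this
      convert this using 2 <;> (funext m; fin_cases m <;> rfl)
  | neg φ ih => exact fun hk a a' h => not_congr (ih hk h)
  | ex x φ ih =>
    intro hk a a' h
    have hx : x < k := hk x (Or.inl rfl)
    have hk' : ∀ y ∈ φ.vars, y < k := fun y hy => hk y (Or.inr hy)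
    constructor
    · rintro ⟨d, hd⟩
      obtain ⟨d', h'⟩ := h.exists_update hj hj' ⟨x, hx⟩ d
      exact ⟨d', (ih hk' h').1 hd⟩
    · rintro ⟨d, hd⟩
      obtain ⟨d', h'⟩ := h.symm.exists_update hj' hj ⟨x, hx⟩ d
      exact ⟨d', (ih hk' h'.symm).2 hd⟩
  | all x φ ih =>
    intro hk a a' h
    have hx : x < k := hk x (Or.inl rfl)
    have hk' : ∀ y ∈ φ.vars, y < k := fun y hy => hk y (Or.inr hy)
    constructor
    · intro H d
      obtain ⟨d', h'⟩ := h.symm.exists_update hj' hj ⟨x, hx⟩ d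
      exact (ih hk' h'.symm).1 (H d')
    · intro H d
      obtain ⟨d', h'⟩ := h.exists_update hj hj' ⟨x, hx⟩ d
      exact (ih hk' h').2 (H d')
  | disj φ ih =>
    intro hk a a' h
    exact exists_congr fun i => ih i (fun x hx => hk x (Set.mem_iUnion.2 ⟨i, hx⟩)) h
  | conj φ ih =>
    intro hk a a' h
    exact forall_congr' fun i => ih i (fun x hx => hk x (Set.mem_iUnion.2 ⟨i, hx⟩)) h

end Generic

/-! ### Counting proof that finite generic colored digraphs exist. -/

section Counting

/-- The number of Boolean functions that differ from `π` somewhere on each of the disjoint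
blocks `β n`. -/
theorem card_avoiding_le {X ι : Type*} [Fintype X] [DecidableEq X] [DecidableEq ι]
    (π : X → Bool) (β : ι → Finset X) (t : ℕ) (A : Finset ι) (hcard : ∀ n ∈ A, (β n).card ≤ t)
    (hdisj : ∀ n ∈ A, ∀ m ∈ A, n ≠ m → Disjoint (β n) (β m)) :
    (Finset.univ.filter fun ω : X → Bool => ∀ n ∈ A, ∃ x ∈ β n, ω x ≠ π x).card *
      (2 ^ t) ^ A.card ≤ (2 ^ t - 1) ^ A.card * 2 ^ Fintype.card X := by
  induction A using Finset.induction_on with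
  | empty => simp
  | insert m A hm ih =>
    have ih := ih (fun n hn => hcard n (Finset.mem_insert_of_mem hn))
      fun n hn m hm => hdisj n (Finset.mem_insert_of_mem hn) m (Finset.mem_insert_of_mem hm)
    set Bad := Finset.univ.filter fun ω : X → Bool => ∀ n ∈ A, ∃ x ∈ β n, ω x ≠ π x with hBad
    set Bad' := Finset.univ.filter fun ω : X → Bool =>
      ∀ n ∈ insert m A, ∃ x ∈ β n, ω x ≠ π x with hBad'
    have hsub : Bad' ⊆ Bad := by
      intro ω hω
      simp only [hBad, hBad', Finset.mem_filter, Finset.mem_univ, true_and] at hω ⊢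
      exact fun n hn => hω n (Finset.mem_insert_of_mem hn)
    -- Overwriting `ω` by `π` on the new block keeps the other blocks bad, by disjointness, and
    -- makes this one good. Each fibre has at most `2 ^ t` elements, so each new block costs a
    -- factor `1 - 2 ^ (-t)`.
    let F : (X → Bool) → X → Bool := fun ω x => if x ∈ β m then π x else ω x
    have hF : ∀ ω ∈ Bad, F ω ∈ Bad \ Bad' := by
      intro ω hω
      simp only [hBad, hBad', Finset.mem_sdiff, Finset.mem_filter, Finset.mem_univ, true_and] at hω ⊢
      refine ⟨fun n hn => ?_, fun h => ?_⟩
      · obtain ⟨x, hx, hne⟩ := hω n hn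
        have hd := hdisj n (Finset.mem_insert_of_mem hn) m (Finset.mem_insert_self _ _)
          (fun e => hm (e ▸ hn))
        exact ⟨x, hx, by simpa [F, Finset.disjoint_left.1 hd hx] using hne⟩
      · obtain ⟨x, hx, hne⟩ := h m (Finset.mem_insert_self _ _)
        simp [F, hx] at hne
    have hfib : Bad.card ≤ 2 ^ t * (Bad \ Bad').card := by
      refine Finset.card_le_mul_card_image_of_maps_to hF _ fun ω' _ => ?_
      have hinj : Set.InjOn (fun (ω : X → Bool) (x : β m) => ω x)
          ((Bad.filter fun ω => F ω = ω' : Finset (X → Bool)) : Set (X → Bool)) := by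
        intro ω₁ h₁ ω₂ h₂ he
        simp only [Finset.coe_filter, Set.mem_ofPred_eq] at h₁ h₂
        funext x
        by_cases hx : x ∈ β m
        · exact congrFun he ⟨x, hx⟩
        · have := congrFun (h₁.2.trans h₂.2.symm) x
          simpa [F, hx] using this
      calc (Bad.filter fun ω => F ω = ω').card
          = ((Bad.filter fun ω => F ω = ω').image fun (ω : X → Bool) (x : β m) => ω x).card :=
            (Finset.card_image_of_injOn hinj).symm
        _ ≤ Fintype.card (β m → Bool) := Finset.card_le_univ _
        _ = 2 ^ (β m).card := by simp
        _ ≤ 2 ^ t := Nat.pow_le_pow_right (by norm_num) (hcard m (Finset.mem_insert_self _ _))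
    rw [Finset.card_sdiff_of_subset hsub] at hfib
    have hle := Finset.card_le_card hsub
    have h2 : 2 ^ t * Bad'.card ≤ (2 ^ t - 1) * Bad.card := by
      obtain ⟨q, hq⟩ : ∃ q, 2 ^ t = q + 1 := ⟨2 ^ t - 1, by have := Nat.one_le_two_pow (n := t); omega⟩
      rw [hq] at hfib ⊢
      obtain ⟨r, hr⟩ := Nat.exists_eq_add_of_le hle
      rw [hr] at hfib ⊢
      simp only [Nat.add_sub_cancel_left, Nat.add_sub_cancel] at hfib ⊢
      nlinarith
    rw [Finset.card_insert_of_notMem hm, pow_succ, pow_succ]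
    calc Bad'.card * ((2 ^ t) ^ A.card * 2 ^ t)
        = (2 ^ t * Bad'.card) * (2 ^ t) ^ A.card := by ring
      _ ≤ ((2 ^ t - 1) * Bad.card) * (2 ^ t) ^ A.card := Nat.mul_le_mul_right _ h2
      _ = (2 ^ t - 1) * (Bad.card * (2 ^ t) ^ A.card) := by ring
      _ ≤ (2 ^ t - 1) * ((2 ^ t - 1) ^ A.card * 2 ^ Fintype.card X) := Nat.mul_le_mul_left _ ih
      _ = _ := by ring

/-- A polynomial in `n` is beaten by the decay of `(1 - 2 ^ (-t)) ^ n`. This makes the union bound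
over all extension requirements smaller than the number of all digraphs. -/
theorem exists_mul_pow_lt (k m t : ℕ) (q : ℕ) :
    ∃ n, k ≤ n ∧ (n * m) ^ k * q * (2 ^ t - 1) ^ (n - k) < (2 ^ t) ^ (n - k) := by
  set r : ℝ := (2 ^ t - 1) / 2 ^ t with hr
  have h2 : (0 : ℝ) < 2 ^ t := by positivity
  have h1 : (1 : ℝ) ≤ 2 ^ t := one_le_pow₀ (by norm_num)
  have hr0 : 0 ≤ r := div_nonneg (by linarith) h2.le
  have hr1 : r < 1 := by rw [hr, div_lt_one h2]; linarith
  have ht := (tendsto_pow_const_mul_const_pow_of_lt_one k hr0 hr1).const_mul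
    (((m : ℝ) ^ k * q) * (2 ^ t) ^ k)
  rw [mul_zero] at ht
  -- The ratio vanishes only for `t = 0`, where the division by `r ^ k` below would fail.
  by_cases hr' : r = 0
  · have h3 : (2 : ℝ) ^ t - 1 = 0 := by
      rw [hr, div_eq_zero_iff] at hr'
      exact hr'.resolve_right h2.ne'
    have h4 : 2 ^ t - 1 = 0 := by
      have : ((2 ^ t : ℕ) : ℝ) = (1 : ℕ) := by push_cast; linarith
      have := Nat.cast_injective this
      omega
    refine ⟨k + 1, by omega, ?_⟩
    rw [h4]
    simp
  have hrpos : 0 < r := lt_of_le_of_ne hr0 (Ne.symm hr')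
  have hpos : 0 < r ^ k := pow_pos hrpos k
  have ht' := ht.eventually_lt_const (show (0 : ℝ) < (r ^ k) * (2 ^ t) ^ k by positivity)
  obtain ⟨n, hn, hkn⟩ := (ht'.and (Filter.eventually_ge_atTop k)).exists
  refine ⟨n, hkn, ?_⟩
  obtain ⟨d, rfl⟩ := Nat.exists_eq_add_of_le hkn
  rw [Nat.add_sub_cancel_left]
  have hcast : ((2 ^ t - 1 : ℕ) : ℝ) = r * 2 ^ t := by
    rw [Nat.cast_sub Nat.one_le_two_pow, hr]
    push_cast
    field_simp
  have : (((k + d) * m : ℕ) ^ k * q * (2 ^ t - 1 : ℕ) ^ d : ℝ) < (2 ^ t) ^ d := by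
    rw [hcast, mul_pow]
    push_cast
    have e : ((k : ℝ) + d) ^ k * m ^ k * q * r ^ d < 1 := by
      push_cast at hn
      rw [pow_add] at hn
      have : (((k : ℝ) + d) ^ k * m ^ k * q * r ^ d) * (r ^ k * (2 ^ t) ^ k) <
        1 * (r ^ k * (2 ^ t) ^ k) := by
        calc _ = (m : ℝ) ^ k * q * (2 ^ t) ^ k * (((k : ℝ) + d) ^ k * (r ^ k * r ^ d)) := by ring
          _ < _ := hn
          _ = _ := (one_mul _).symm
      exact lt_of_mul_lt_mul_right this (by positivity)
    calc _ = (((k : ℝ) + d) ^ k * m ^ k * q * r ^ d) * (2 ^ t) ^ d := by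
          rw [mul_pow ((k : ℝ) + d)]; ring
      _ < 1 * (2 ^ t) ^ d := mul_lt_mul_of_pos_right e (by positivity)
      _ = _ := one_mul _
  exact_mod_cast this

/-- There are finite colored digraphs in which every way to connect a new vertex with `k` given
ones is realized in every color. -/
theorem exists_generic_digraph (C : Type w) [Finite C] (k : ℕ) :
    ∃ (n : ℕ) (ω : (Fin n × C) × (Fin n × C) → Bool),
      k ≤ n ∧ ∀ (s : Fin k → Fin n × C), Function.Injective s → ∀ (c : C) (p : Fin k → Bool × Bool),
        ∃ m, (∀ l, s l ≠ (m, c)) ∧ ∀ l, (ω (s l, (m, c)), ω ((m, c), s l)) = p l := by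
  classical
  have := Fintype.ofFinite C
  obtain ⟨n, hkn, hn⟩ := exists_mul_pow_lt k (Fintype.card C) (2 * k) (Fintype.card C * 4 ^ k)
  refine ⟨n, ?_⟩
  let V := Fin n × C
  by_contra hcon
  simp only [hkn, true_and] at hcon
  push Not at hcon
  let Idx := (Fin k → V) × C × (Fin k → Bool × Bool)
  let bad : Idx → Finset (V × V → Bool) := fun x => Finset.univ.filter fun ω =>
    Function.Injective x.1 ∧ ∀ m, (∀ l, x.1 l ≠ (m, x.2.1)) →
      ∃ l, (ω (x.1 l, (m, x.2.1)), ω ((m, x.2.1), x.1 l)) ≠ x.2.2 l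
  have hcover : (Finset.univ : Finset (V × V → Bool)) ⊆ Finset.univ.biUnion bad := by
    intro ω _
    obtain ⟨s, hs, c, p, h⟩ := hcon ω
    exact Finset.mem_biUnion.2 ⟨(s, c, p), Finset.mem_univ _,
      Finset.mem_filter.2 ⟨Finset.mem_univ _, hs, h⟩⟩
  have hbad : ∀ x, (bad x).card * (2 ^ (2 * k)) ^ (n - k) ≤
      (2 ^ (2 * k) - 1) ^ (n - k) * 2 ^ Fintype.card (V × V) := by
    rintro ⟨s, c, p⟩
    by_cases hs : Function.Injective s
    swap
    · have : bad (s, c, p) = ∅ := Finset.filter_false_of_mem fun ω _ h => hs h.1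
      simp [this]
    -- The pattern demanded by `p`. The block of `m` consists of the at most `2 * k` pairs that join
    -- `(m, c)` with the given vertices; blocks of different admissible `m` are disjoint.
    let π : V × V → Bool := fun x =>
      if h : ∃ l, s l = x.1 then (p h.choose).1
      else if h : ∃ l, s l = x.2 then (p h.choose).2 else true
    let β : Fin n → Finset (V × V) := fun m =>
      (Finset.univ.image fun l => (s l, ((m, c) : V))) ∪
        Finset.univ.image fun l => (((m, c) : V), s l)
    let A₀ : Finset (Fin n) := Finset.univ.filter fun m => ∀ l, s l ≠ (m, c)
    have hA₀ : n - k ≤ A₀.card := by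
      have h1 : (Finset.univ \ A₀ : Finset (Fin n)) ⊆ Finset.univ.image fun l => (s l).1 := by
        intro m hm
        simp only [A₀, Finset.mem_sdiff, Finset.mem_univ, Finset.mem_filter, true_and, not_forall,
          not_not] at hm
        obtain ⟨l, hl⟩ := hm
        exact Finset.mem_image.2 ⟨l, Finset.mem_univ _, by rw [hl]⟩
      have h2 := (Finset.card_le_card h1).trans Finset.card_image_le
      rw [Finset.card_sdiff_of_subset (Finset.subset_univ _)] at h2
      simp only [Finset.card_univ, Fintype.card_fin] at h2
      omega
    -- Exactly `n - k` candidates are kept, so that the bound is the same for all requirements.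
    obtain ⟨A, hA, hAc⟩ := Finset.exists_subset_card_eq hA₀
    have hAs : ∀ m ∈ A, ∀ l, s l ≠ (m, c) := fun m hm => (Finset.mem_filter.1 (hA hm)).2
    have key := card_avoiding_le π β (2 * k) A (fun m _ => by
        refine (Finset.card_union_le _ _).trans ?_
        have := Finset.card_image_le (s := (Finset.univ : Finset (Fin k)))
          (f := fun l => (s l, ((m, c) : V)))
        have := Finset.card_image_le (s := (Finset.univ : Finset (Fin k)))
          (f := fun l => (((m, c) : V), s l))
        simp only [Finset.card_univ, Fintype.card_fin] at *
        omega)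
      (fun m hm m' hm' hne => by
        rw [Finset.disjoint_left]
        intro x hx hx'
        simp only [β, Finset.mem_union, Finset.mem_image, Finset.mem_univ, true_and] at hx hx'
        rcases hx with ⟨l, rfl⟩ | ⟨l, rfl⟩ <;> rcases hx' with ⟨l', hl'⟩ | ⟨l', hl'⟩ <;>
          simp only [Prod.mk.injEq] at hl'
        · exact hne (Prod.ext_iff.1 hl'.2).1.symm
        · exact hAs m' hm' l hl'.1.symm
        · exact hAs m hm l' hl'.1
        · exact hne (Prod.ext_iff.1 hl'.1).1.symm)
    rw [hAc] at key
    refine (Nat.mul_le_mul_right _ (Finset.card_le_card ?_)).trans key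
    intro ω hω
    obtain ⟨-, -, hω⟩ := Finset.mem_filter.1 hω
    simp only [Finset.mem_filter, Finset.mem_univ, true_and]
    intro m hm
    obtain ⟨l, hl⟩ := hω m (hAs m hm)
    have hex : ∃ l', s l' = s l := ⟨l, rfl⟩
    have hch : hex.choose = l := hs hex.choose_spec
    have hno : ¬ ∃ l', s l' = (m, c) := fun ⟨l', h⟩ => hAs m hm l' h
    have e1 : π (s l, (m, c)) = (p l).1 := by simp only [π]; rw [dif_pos hex, hch]
    have e2 : π ((m, c), s l) = (p l).2 := by
      simp only [π]; rw [dif_neg hno, dif_pos hex, hch]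
    by_contra hall
    push Not at hall
    apply hl
    ext1
    · rw [← e1]
      exact hall _ (Finset.mem_union_left _ (Finset.mem_image_of_mem _ (Finset.mem_univ l)))
    · rw [← e2]
      exact hall _ (Finset.mem_union_right _ (Finset.mem_image_of_mem _ (Finset.mem_univ l)))
  have hcardIdx : Fintype.card Idx =
      (n * Fintype.card C) ^ k * (Fintype.card C * 4 ^ k) := by
    simp [Idx, V]
  have htot : 2 ^ Fintype.card (V × V) * (2 ^ (2 * k)) ^ (n - k) ≤
      Fintype.card Idx * ((2 ^ (2 * k) - 1) ^ (n - k) * 2 ^ Fintype.card (V × V)) := by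
    calc 2 ^ Fintype.card (V × V) * (2 ^ (2 * k)) ^ (n - k)
        = (Finset.univ : Finset (V × V → Bool)).card * (2 ^ (2 * k)) ^ (n - k) := by
          simp [Finset.card_univ]
      _ ≤ (∑ x, (bad x).card) * (2 ^ (2 * k)) ^ (n - k) :=
          Nat.mul_le_mul_right _ ((Finset.card_le_card hcover).trans Finset.card_biUnion_le)
      _ = ∑ x, (bad x).card * (2 ^ (2 * k)) ^ (n - k) := Finset.sum_mul _ _ _
      _ ≤ ∑ _x : Idx, (2 ^ (2 * k) - 1) ^ (n - k) * 2 ^ Fintype.card (V × V) :=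
          Finset.sum_le_sum fun x _ => hbad x
      _ = _ := by rw [Finset.sum_const, Finset.card_univ, smul_eq_mul]
  rw [hcardIdx] at htot
  have hpos : 0 < 2 ^ Fintype.card (V × V) := by positivity
  have : (2 ^ (2 * k)) ^ (n - k) ≤ (n * Fintype.card C) ^ k * (Fintype.card C * 4 ^ k) *
      (2 ^ (2 * k) - 1) ^ (n - k) := by
    refine Nat.le_of_mul_le_mul_left ?_ hpos
    calc _ ≤ _ := htot
      _ = _ := by ring
  omega

end Counting

/-! ### Finite generic extensions of a finite structure. -/

section Extension

variable {L : FirstOrder.Language.{u, v}} {B Y : Type w} [(addP L).Structure B]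

variable (L) in
/-- The relation `P` on `B ⊕ Y`, if `Y` is connected with `B` by `t` and is ordered by `Q`. -/
def extEdge (t : Y → B → Prop × Prop) (Q : Y → Y → Prop) : B ⊕ Y → B ⊕ Y → Prop
  | Sum.inl b, Sum.inl b' => Edge L b b'
  | Sum.inl b, Sum.inr y => (t y b).1
  | Sum.inr y, Sum.inl b => (t y b).2
  | Sum.inr y, Sum.inr y' => Q y y'

variable (L) in
/-- The extension of `B` by new elements `Y`, connected with `B` by `t` and among each other
by `Q`. -/
abbrev extStructure (t : Y → B → Prop × Prop) (Q : Y → Y → Prop) :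
    (addP L).Structure (B ⊕ Y) where
  funMap {n} f xs :=
    match n, f, xs with
    | 0, f, _ => Sum.inl (FirstOrder.Language.Structure.funMap f Fin.elim0)
    | _ + 1, _, xs => xs 0
  RelMap {n} R xs :=
    match R with
    | Sum.inl R => ∃ ys : Fin n → B, (fun i => Sum.inl (ys i)) = xs ∧
        FirstOrder.Language.Structure.RelMap (L := addP L) (Sum.inl R : (addP L).Relations n) ys
    | Sum.inr R =>
      match n, R, xs with
      | _, PRel.P, xs => extEdge L t Q (xs 0) (xs 1)

theorem pureEmb_inl (t : Y → B → Prop × Prop) (Q : Y → Y → Prop) (hQ : ∀ y, ¬ Q y y) :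
    letI := extStructure L t Q
    PureEmb L (Sum.inl : B → B ⊕ Y) := by
  let := extStructure L t Q
  refine ⟨Sum.inl_injective, fun _ _ => Iff.rfl, fun _ _ => Iff.rfl, fun f xs ys => ?_, ?_⟩
  · rw [Subsingleton.elim xs Fin.elim0]
    rfl
  · rintro (b | y) h
    · exact (h ⟨b, rfl⟩).elim
    · exact hQ y

theorem PureEmb.comp {N M : Type w} [(addP L).Structure N] [(addP L).Structure M] {i : B → N}
    {j : N → M} (hj : PureEmb L j) (hi : PureEmb L i) : PureEmb L fun b => j (i b) where
  inj := hj.inj.comp hi.inj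
  edge b b' := (hj.edge _ _).trans (hi.edge _ _)
  rel R xs := by
    rw [hj.rel]
    constructor
    · rintro ⟨ys, rfl, h⟩
      obtain ⟨zs, rfl, hzs⟩ := (hi.rel R ys).1 h
      exact ⟨zs, rfl, hzs⟩
    · rintro ⟨zs, rfl, h⟩
      exact ⟨fun m => i (zs m), rfl, (hi.rel R _).2 ⟨zs, rfl, h⟩⟩
  const f xs ys := by rw [hj.const f (fun m => i (xs m)), hi.const f xs]
  loopless x hx := by
    by_cases h : x ∈ Set.range j
    · obtain ⟨y, rfl⟩ := h
      rw [hj.edge]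
      refine hi.loopless y ?_
      rintro ⟨b, rfl⟩
      exact hx ⟨b, rfl⟩
    · exact hj.loopless x h

/-- Every finite structure has finite generic extensions. -/
theorem exists_gen [Finite B] (C : Set (B → Prop × Prop)) (κ : ℕ) :
    ∃ (N : Type w) (_ : (addP L).Structure N) (j : B → N), Finite N ∧ Gen L C κ j := by
  classical
  obtain ⟨n, ω, hn, hω⟩ := exists_generic_digraph C κ
  -- The color of a vertex is its trace on `B`. Loops are deleted from the digraph, since `P` may
  -- have loops only in the base.
  let t : Fin n × C → B → Prop × Prop := fun u => u.2.1
  let Q : Fin n × C → Fin n × C → Prop := fun u v => u ≠ v ∧ ω (u, v) = true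
  let str := extStructure L t Q
  refine ⟨B ⊕ (Fin n × C), str, Sum.inl, inferInstance,
    { pureEmb_inl t Q fun y h => h.1 rfl with trace_mem := ?_, ext := ?_ }⟩
  · rintro (b | u) h
    · exact (h ⟨b, rfl⟩).elim
    · exact u.2.2
  · intro S hS hc c hcC p
    have := Fintype.ofFinite C
    have hcard : κ ≤ Fintype.card (Fin n × C) := by
      rw [Fintype.card_prod, Fintype.card_fin]
      have : 0 < Fintype.card C := Fintype.card_pos_iff.2 ⟨⟨c, hcC⟩⟩
      exact hn.trans (Nat.le_mul_of_pos_right n this)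
    let S' : Finset (Fin n × C) := S.preimage Sum.inr Sum.inr_injective.injOn
    have hS' : S'.card ≤ κ := by
      refine le_trans ?_ hc.le
      rw [← Finset.card_image_of_injective S' (Sum.inr_injective (α := B))]
      refine Finset.card_le_card fun x hx => ?_
      obtain ⟨y, hy, rfl⟩ := Finset.mem_image.1 hx
      exact Finset.mem_preimage.1 hy
    -- The digraph property speaks of exactly `κ` vertices, so the given set is padded.
    obtain ⟨T, hST, hT⟩ := Finset.exists_superset_card_eq hS' hcard
    let s : Fin κ → Fin n × C := fun l => (T.equivFinOfCardEq hT).symm l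
    have hs : Function.Injective s :=
      Subtype.val_injective.comp (T.equivFinOfCardEq hT).symm.injective
    obtain ⟨m, hm, hp⟩ := hω s hs ⟨c, hcC⟩
      fun l => (decide (p (Sum.inr (s l))).1, decide (p (Sum.inr (s l))).2)
    have hsurj : ∀ y, Sum.inr y ∈ S → ∃ l, s l = y := fun y hy =>
      ⟨T.equivFinOfCardEq hT ⟨y, hST (Finset.mem_preimage.2 hy)⟩, by simp [s]⟩
    refine ⟨Sum.inr (m, ⟨c, hcC⟩), (by rintro ⟨b, h⟩; cases h), fun h => ?_, rfl, fun x hx => ?_⟩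
    · obtain ⟨l, hl⟩ := hsurj _ h
      exact hm l hl
    · rcases x with b | y
      · exact (hS _ hx ⟨b, rfl⟩).elim
      · obtain ⟨l, rfl⟩ := hsurj y hx
        have h := hp l
        simp only [Prod.mk.injEq] at h
        have e1 : Edge L (Sum.inr (s l) : B ⊕ (Fin n × C)) (Sum.inr (m, ⟨c, hcC⟩)) ↔
            (s l ≠ (m, ⟨c, hcC⟩) ∧ ω (s l, (m, ⟨c, hcC⟩)) = true) := Iff.rfl
        have e2 : Edge L (Sum.inr (m, ⟨c, hcC⟩) : B ⊕ (Fin n × C)) (Sum.inr (s l)) ↔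
            ((m, ⟨c, hcC⟩) ≠ s l ∧ ω ((m, ⟨c, hcC⟩), s l) = true) := Iff.rfl
        rw [h.1] at e1
        rw [h.2] at e2
        ext1 <;> simp only [edgeType, eq_iff_iff]
        · rw [e1]; simp [hm l]
        · rw [e2]; simp [(hm l).symm]

end Extension

/-! ### Coding atomic types by traces. -/

section Coding

variable (L : FirstOrder.Language.{u, v})

/-- The positions of a code for a `k`-tuple. -/
abbrev CodeIdx (k : ℕ) : Type := Fin k ⊕ Fin k ⊕ (Fin k × Fin k) ⊕ (Fin k × Fin k)

/-- The trace of an outer element, or the singleton of an inner one. -/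
def codeTrace {B N : Type w} [(addP L).Structure N] (j : B → N) (x : N) : B → Prop × Prop :=
  fun b => (x ∈ Set.range j ∧ j b = x ∨ x ∉ Set.range j ∧ Edge L (j b) x,
    x ∈ Set.range j ∧ j b = x ∨ x ∉ Set.range j ∧ Edge L x (j b))

/-- `c` describes the atomic `P`-type of the first `k` values of `a`. -/
structure Codes {B N : Type w} [(addP L).Structure N] (k : ℕ) (j : B → N)
    (c : CodeIdx k → B → Prop × Prop) (a : ℕ → N) : Prop where
  tr : ∀ l : Fin k, c (Sum.inl l) = codeTrace L j (a l)
  inner : ∀ l : Fin k, (∃ b, (c (Sum.inr (Sum.inl l)) b).1) ↔ a l ∈ Set.range j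
  eq : ∀ l l' : Fin k, (∃ b, (c (Sum.inr (Sum.inr (Sum.inl (l, l')))) b).1) ↔ a l = a l'
  edge : ∀ l l' : Fin k,
    (∃ b, (c (Sum.inr (Sum.inr (Sum.inr (l, l')))) b).1) ↔ Edge L (a l) (a l')

variable {L} {B N N' : Type w} [(addP L).Structure B] [(addP L).Structure N]
  [(addP L).Structure N']

omit [(addP L).Structure B] in
theorem codeTrace_inner {j : B → N} (hj : Function.Injective j) (b : B) :
    codeTrace L j (j b) = fun z => (z = b, z = b) := by
  funext z
  simp [codeTrace, hj.eq_iff]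

omit [(addP L).Structure B] in
theorem codeTrace_outer {j : B → N} {x : N} (hx : x ∉ Set.range j) :
    codeTrace L j x = trace L j x := by
  funext z
  simp only [codeTrace, hx, false_and, false_or, not_false_eq_true, true_and]
  rfl

/-- A code determines the atomic type: the singleton identifies an inner element, the trace gives
the connections of an outer one with the base, and the remaining bits settle equality and `P`
between variables. The bit `inner` is needed since the trace of an outer element may look like a
singleton. -/
theorem Codes.sim {k : ℕ} {j : B → N} {j' : B → N'} {a : ℕ → N} {a' : ℕ → N'}
    {c : CodeIdx k → B → Prop × Prop} (hj : PureEmb L j) (hj' : PureEmb L j')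
    (h : Codes L k j c a) (h' : Codes L k j' c a') : Sim L k j j' a a' := by
  have hin : ∀ l : Fin k, (∃ b, a l = j b ∧ a' l = j' b) ∨
      (a l ∉ Set.range j ∧ a' l ∉ Set.range j' ∧ trace L j (a l) = trace L j' (a' l)) := by
    intro l
    have e := (h.inner l).symm.trans (h'.inner l)
    have ht := (h.tr l).symm.trans (h'.tr l)
    by_cases hl : a l ∈ Set.range j
    · obtain ⟨b, hb⟩ := hl
      obtain ⟨b', hb'⟩ := e.1 ⟨b, hb⟩
      rw [← hb, ← hb', codeTrace_inner hj.inj, codeTrace_inner hj'.inj] at ht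
      have : b = b' := by
        have := (Prod.ext_iff.1 (congrFun ht b)).1
        simpa using this
      subst this
      exact Or.inl ⟨b, hb.symm, hb'.symm⟩
    · have hl' : a' l ∉ Set.range j' := fun x => hl (e.2 x)
      rw [codeTrace_outer hl, codeTrace_outer hl'] at ht
      exact Or.inr ⟨hl, hl', ht⟩
  have hmix : ∀ (l : Fin k) (b : B), (a l = j b ↔ a' l = j' b) ∧
      (Edge L (j b) (a l) ↔ Edge L (j' b) (a' l)) ∧
      (Edge L (a l) (j b) ↔ Edge L (a' l) (j' b)) := by
    intro l b
    rcases hin l with ⟨b', e, e'⟩ | ⟨hl, hl', ht⟩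
    · rw [e, e', hj.inj.eq_iff, hj'.inj.eq_iff, hj.edge, hj'.edge, hj.edge, hj'.edge]
      exact ⟨Iff.rfl, Iff.rfl, Iff.rfl⟩
    · have hb := congrFun ht b
      simp only [trace, edgeType, Prod.mk.injEq, eq_iff_iff] at hb
      exact ⟨iff_of_false (fun x => hl ⟨b, x.symm⟩) fun x => hl' ⟨b, x.symm⟩, hb⟩
  rintro (l | b) (l' | b') <;> simp only [val, Sum.elim_inl, Sum.elim_inr]
  · exact ⟨(h.eq l l').symm.trans (h'.eq l l'), (h.edge l l').symm.trans (h'.edge l l')⟩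
  · exact ⟨(hmix l b').1, (hmix l b').2.2⟩
  · exact ⟨by rw [eq_comm, (hmix l' b).1, eq_comm], (hmix l' b).2.1⟩
  · rw [hj.inj.eq_iff, hj'.inj.eq_iff, hj.edge, hj'.edge]
    exact ⟨Iff.rfl, Iff.rfl⟩

/-- The set of traces contains the empty trace and the traces of singletons. -/
def Rich (C : Set (B → Prop × Prop)) : Prop :=
  (fun _ => (False, False)) ∈ C ∧ ∀ b : B, (fun z => (z = b, z = b)) ∈ C

/-- Richness is tailored to this: singletons code inner elements, and a bit is a singleton if true
and the empty trace if false. -/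
theorem exists_codes [Nonempty B] {C : Set (B → Prop × Prop)} (hC : Rich C) {k : ℕ}
    {j : B → N} (hj : Gen L C k j) (a : ℕ → N) :
    ∃ c : CodeIdx k → C, Codes L k j (fun i => (c i).1) a := by
  classical
  obtain ⟨b₀⟩ := ‹Nonempty B›
  let bit : Prop → C := fun p =>
    if p then ⟨fun z => (z = b₀, z = b₀), hC.2 b₀⟩ else ⟨fun _ => (False, False), hC.1⟩
  have hbit : ∀ p : Prop, (∃ b, ((bit p).1 b).1) ↔ p := by
    intro p
    by_cases hp : p <;> simp [bit, hp]
  have htr : ∀ x : N, codeTrace L j x ∈ C := by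
    intro x
    by_cases hx : x ∈ Set.range j
    · obtain ⟨b, rfl⟩ := hx
      rw [codeTrace_inner hj.inj]
      exact hC.2 b
    · rw [codeTrace_outer hx]
      exact hj.trace_mem x hx
  exact ⟨Sum.elim (fun l => ⟨_, htr (a l)⟩) (Sum.elim (fun l => bit (a l ∈ Set.range j))
    (Sum.elim (fun q => bit (a q.1 = a q.2)) fun q => bit (Edge L (a q.1) (a q.2)))),
    fun l => rfl, fun l => hbit _, fun l l' => hbit _, fun l l' => hbit _⟩

end Coding

/-! ### One coding step: attaching tournaments and recognizing them. -/

section Next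

variable {L : FirstOrder.Language.{u, v}} {B : Type w} [(addP L).Structure B]
  (C : Set (B → Prop × Prop)) {k K : ℕ} (e : CodeIdx k ↪ Fin K)
  (φ : InfFormula.{u, v, i} (addP L))

/-- A code of a tuple that satisfies `φ` in some generic extension. -/
def GoodCode (c : Fin K → C) : Prop :=
  ∃ (N : Type w) (_ : (addP L).Structure N) (j : B → N) (a : ℕ → N),
    Gen L C k j ∧ Codes L k j (fun i => (c (e i)).1) a ∧ φ.Realize a

/-- The extension of `B` by one transitive tournament of size `K` for every good code. -/
def Next : Type w := B ⊕ ({c : Fin K → C // GoodCode C e φ c} × Fin K)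

instance Next.structure : (addP L).Structure (Next C e φ) :=
  extStructure L (B := B) (Y := {c : Fin K → C // GoodCode C e φ c} × Fin K)
    (fun y => (y.1.1 y.2).1) fun y y' => y.1 = y'.1 ∧ y.2 < y'.2

instance Next.finite [Finite B] : Finite (Next C e φ) :=
  inferInstanceAs (Finite (B ⊕ ({c : Fin K → C // GoodCode C e φ c} × Fin K)))

variable {C e φ}

/-- The inclusion of the old elements. -/
def Next.old (b : B) : Next C e φ := Sum.inl b

/-- The elements of the new tournaments. -/
def Next.new (c : {c : Fin K → C // GoodCode C e φ c}) (m : Fin K) : Next C e φ := Sum.inr (c, m)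

variable (C e φ) in
/-- The traces over the extension that omit an element of every new tournament. -/
def nextColors : Set (Next C e φ → Prop × Prop) :=
  {t | (fun b => t (Next.old b)) ∈ C ∧ ∀ c, ∃ m, t (Next.new c m) = (False, False)}

theorem Next.cases (x : Next C e φ) : (∃ b, x = Next.old b) ∨ ∃ c m, x = Next.new c m := by
  rcases x with b | ⟨c, m⟩
  · exact Or.inl ⟨b, rfl⟩
  · exact Or.inr ⟨c, m, rfl⟩

theorem Next.pureEmb_old : PureEmb L (Next.old : B → Next C e φ) :=
  pureEmb_inl _ _ fun _ h => lt_irrefl _ h.2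

theorem Next.edge_new_new (c c' m m') :
    Edge L (Next.new c m : Next C e φ) (Next.new c' m') ↔ c = c' ∧ m < m' := Iff.rfl

theorem Next.new_inj {c c' : {c : Fin K → C // GoodCode C e φ c}} {m m' : Fin K} :
    (Next.new c m : Next C e φ) = Next.new c' m' ↔ c = c' ∧ m = m' := by
  simp only [Next.new]
  exact Sum.inr_injective.eq_iff.trans Prod.mk_inj

theorem Next.new_ne_old (b : B) (c m) : (Next.new c m : Next C e φ) ≠ Next.old b := by
  rintro ⟨⟩

/-- With at least two vertices in each tournament, the singleton of a vertex still omits another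
vertex of its tournament, so coding can be repeated over the extension. -/
theorem nextColors_rich (hC : Rich C) (hK : 2 ≤ K) : Rich (nextColors C e φ) := by
  have hnt : Nontrivial (Fin K) := Fin.nontrivial_iff_two_le.2 hK
  refine ⟨⟨hC.1, fun c => ⟨⟨0, by omega⟩, rfl⟩⟩, fun x => ?_⟩
  rcases x.cases with ⟨b, rfl⟩ | ⟨c, m, rfl⟩
  · refine ⟨?_, fun c => ⟨⟨0, by omega⟩, ?_⟩⟩
    · convert hC.2 b using 4 <;> exact Next.pureEmb_old.inj.eq_iff
    · simp [Next.new_ne_old]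
  · refine ⟨?_, fun c' => ?_⟩
    · convert hC.1 using 4 <;> simpa using (Next.new_ne_old _ _ _).symm
    · obtain ⟨m', hm'⟩ := exists_ne m
      refine ⟨m', ?_⟩
      simp [Next.new_inj, hm']

variable {N : Type w} [(addP L).Structure N] {κ : ℕ} {j : Next C e φ → N}

theorem edgeType_map {B N : Type w} [(addP L).Structure B] [(addP L).Structure N] {j : B → N}
    (hj : PureEmb L j) (x y : B) : edgeType L (j x) (j y) = edgeType L x y := by
  simp only [edgeType, Prod.mk.injEq, eq_iff_iff]
  exact ⟨hj.edge x y, hj.edge y x⟩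

theorem trace_new (hj : PureEmb L j) (c m) :
    trace L (fun b => j (Next.old b)) (j (Next.new c m)) = (c.1 m).1 :=
  funext fun _ => edgeType_map hj _ _

/-- A generic extension of the extension is a generic extension of the base. -/
theorem Gen.old (hj : Gen L (nextColors C e φ) κ j) (hK : K ≤ κ) :
    Gen L C K fun b => j (Next.old b) := by
  classical
  refine { hj.toPureEmb.comp Next.pureEmb_old with trace_mem := ?_, ext := ?_ }
  · intro x hx
    by_cases h : x ∈ Set.range j
    · obtain ⟨y, rfl⟩ := h
      rcases y.cases with ⟨b, rfl⟩ | ⟨c, m, rfl⟩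
      · exact (hx ⟨b, rfl⟩).elim
      · rw [trace_new hj.toPureEmb]
        exact (c.1 m).2
    · exact (hj.trace_mem x h).1
  · intro S hS hc c hcC p
    -- Tournament vertices are outer over the old base, so demands on those in `S` become part of
    -- the trace over the extension. This trace is admissible because `S`, having fewer than `K`
    -- elements, contains no whole tournament.
    let t : Next C e φ → Prop × Prop :=
      Sum.elim c fun y => if j (Sum.inr y) ∈ S then p (j (Sum.inr y)) else (False, False)
    have ht : t ∈ nextColors C e φ := by
      refine ⟨hcC, fun r => ?_⟩
      by_contra hcon
      push Not at hcon
      have hmem : ∀ m, j (Next.new r m) ∈ S := by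
        intro m
        by_contra h
        exact hcon m (if_neg h)
      have hle := Finset.card_le_card_of_injOn (s := Finset.univ) (t := S)
        (fun m => j (Next.new r m)) (fun m _ => hmem m) fun m _ m' _ h =>
          (Next.new_inj.1 (hj.inj h)).2
      rw [Finset.card_univ, Fintype.card_fin] at hle
      omega
    obtain ⟨d, hd, hdS, htr, hp⟩ := hj.ext (S.filter fun s => s ∉ Set.range j)
      (fun s hs => (Finset.mem_filter.1 hs).2)
      ((Finset.card_filter_le _ _).trans_lt (hc.trans_le hK)) t ht p
    refine ⟨d, fun ⟨b, h⟩ => hd ⟨_, h⟩, fun h => hdS (Finset.mem_filter.2 ⟨h, hd⟩), ?_, ?_⟩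
    · exact funext fun b => congrFun htr (Next.old b)
    · intro s hs
      by_cases h : s ∈ Set.range j
      · obtain ⟨y, rfl⟩ := h
        rcases y.cases with ⟨b, rfl⟩ | ⟨r, m, rfl⟩
        · exact (hS _ hs ⟨b, rfl⟩).elim
        · exact (congrFun htr (Next.new r m)).trans (if_pos hs)
      · exact hp s (Finset.mem_filter.2 ⟨hs, h⟩)

variable (L) in
/-- `y` is a maximal transitive tournament outside `I`. -/
def MaxTour {N : Type w} [(addP L).Structure N] (I : N → Prop) {K : ℕ} (y : Fin K → N) : Prop :=
  (∀ m, ¬ I (y m)) ∧ (∀ m m', Edge L (y m) (y m') ↔ m < m') ∧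
    ∀ z, ¬ I z → ∃ m, ¬ Edge L (y m) z ∧ ¬ Edge L z (y m)

/-- The new tournaments are precisely the maximal ones. -/
theorem maxTour_iff (hC : Rich C) (hj : Gen L (nextColors C e φ) κ j) (hκ : K < κ)
    (y : Fin K → N) :
    MaxTour L (fun x => x ∈ Set.range fun b => j (Next.old b)) y ↔
      ∃ r, ∀ m, y m = j (Next.new r m) := by
  classical
  have hnew : ∀ r m, j (Next.new r m) ∉ Set.range fun b => j (Next.old b) := by
    rintro r m ⟨b, h⟩
    exact Next.new_ne_old _ _ _ (hj.inj h).symm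
  constructor
  · rintro ⟨h1, h2, h3⟩
    by_contra hcon
    push Not at hcon
    -- If `y` ran through a whole new tournament, the order would force it to list that tournament:
    -- a strictly increasing self-map of `Fin K` is the identity.
    have hex : ∀ r, ∃ m, j (Next.new r m) ∉ Set.range y := by
      intro r
      by_contra hr
      push Not at hr
      choose σ hσ using hr
      have hmono : StrictMono σ := by
        intro m m' hm
        rw [← h2, hσ, hσ, hj.edge, Next.edge_new_new]
        exact ⟨rfl, hm⟩
      obtain ⟨m, hm⟩ := hcon r
      apply hm
      have : σ m = m := le_antisymm hmono.apply_le hmono.le_apply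
      rw [← hσ m, this]
    let t : Next C e φ → Prop × Prop :=
      Sum.elim (fun _ => (False, False))
        fun q => if j (Sum.inr q) ∈ Set.range y then (True, True) else (False, False)
    have ht : t ∈ nextColors C e φ := by
      refine ⟨hC.1, fun r => ?_⟩
      obtain ⟨m, hm⟩ := hex r
      exact ⟨m, if_neg hm⟩
    -- Since `y` misses a vertex of each new tournament, some `d` may be connected with all of `y`,
    -- which contradicts maximality. At most `K` outer elements are involved, hence the strict `K <
    -- κ`.
    obtain ⟨d, hd, -, htr, hp⟩ := hj.ext ((Finset.univ.image y).filter fun s => s ∉ Set.range j)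
      (fun s hs => (Finset.mem_filter.1 hs).2)
      ((Finset.card_filter_le _ _).trans_lt (Finset.card_image_le.trans_lt (by simpa using hκ)))
      t ht fun _ => (True, True)
    obtain ⟨m, hm⟩ := h3 d fun ⟨b, h⟩ => hd ⟨_, h⟩
    have hcon : edgeType L (y m) d = (True, True) := by
      by_cases h : y m ∈ Set.range j
      · obtain ⟨q, hq⟩ := h
        rcases q.cases with ⟨b, rfl⟩ | ⟨r, m', rfl⟩
        · exact (h1 m ⟨b, hq⟩).elim
        · rw [← hq]
          exact (congrFun htr (Next.new r m')).trans (if_pos ⟨m, hq.symm⟩)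
      · exact hp _ (Finset.mem_filter.2 ⟨Finset.mem_image_of_mem _ (Finset.mem_univ _), h⟩)
    simp only [edgeType, Prod.mk.injEq, eq_iff_iff, iff_true] at hcon
    exact hm.1 hcon.1
  · rintro ⟨r, hr⟩
    refine ⟨fun m => by rw [hr]; exact hnew r m, fun m m' => ?_, fun z hz => ?_⟩
    · rw [hr, hr, hj.edge, Next.edge_new_new]
      simp
    -- A vertex of the extension is unconnected with the vertex of the same index: it is either that
    -- very vertex, without a loop, or lies in another tournament. A later element omits some vertex
    -- by the choice of colors.
    · by_cases h : z ∈ Set.range j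
      · obtain ⟨q, rfl⟩ := h
        rcases q.cases with ⟨b, rfl⟩ | ⟨r', m', rfl⟩
        · exact (hz ⟨b, rfl⟩).elim
        · refine ⟨m', ?_⟩
          rw [hr, hj.edge, hj.edge, Next.edge_new_new, Next.edge_new_new]
          exact ⟨fun h => lt_irrefl _ h.2, fun h => lt_irrefl _ h.2⟩
      · obtain ⟨m, hm⟩ := (hj.trace_mem z h).2 r
        simp only [trace, edgeType, Prod.mk.injEq, eq_iff_iff, iff_false] at hm
        exact ⟨m, by rw [hr]; exact hm⟩

theorem mem_range_next_iff (hC : Rich C) (hj : Gen L (nextColors C e φ) κ j) 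
    (hκ : K < κ) (x : N) :
    x ∈ Set.range j ↔ (x ∈ Set.range fun b => j (Next.old b)) ∨
      ∃ y : Fin K → N, MaxTour L (fun x => x ∈ Set.range fun b => j (Next.old b)) y ∧
        ∃ m, x = y m := by
  simp only [maxTour_iff hC hj hκ]
  constructor
  · rintro ⟨q, rfl⟩
    rcases q.cases with ⟨b, rfl⟩ | ⟨r, m, rfl⟩
    · exact Or.inl ⟨b, rfl⟩
    · exact Or.inr ⟨fun m => j (Next.new r m), ⟨r, fun _ => rfl⟩, m, rfl⟩
  · rintro (⟨b, rfl⟩ | ⟨y, ⟨r, hr⟩, m, rfl⟩)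
    · exact ⟨_, rfl⟩
    · exact ⟨_, (hr m).symm⟩

/-- The truth of `φ` can be read off from the maximal tournaments. -/
theorem realize_iff_exists_maxTour (hL : IsVocabulary L) [Nonempty B] (hC : Rich C)
    (hj : Gen L (nextColors C e φ) κ j) (hkK : k ≤ K) (hκ : K < κ)
    (hφ : ∀ x ∈ φ.vars, x < k) (a : ℕ → N) :
    φ.Realize a ↔ ∃ y : Fin K → N,
      MaxTour L (fun x => x ∈ Set.range fun b => j (Next.old b)) y ∧
        Codes L k (fun b => j (Next.old b))
          (fun i => trace L (fun b => j (Next.old b)) (y (e i))) a := by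
  have hg : Gen L C k fun b => j (Next.old b) := (hj.old hκ.le).mono hkK
  simp only [maxTour_iff hC hj hκ]
  constructor
  · intro ha
    obtain ⟨c, hc⟩ := exists_codes hC hg a
    -- Positions that carry no information are filled with the empty trace.
    let c' : Fin K → C := Function.extend e c fun _ => ⟨_, hC.1⟩
    have hc' : ∀ i, c' (e i) = c i := fun i => e.injective.extend_apply _ _ _
    have hc'a : Codes L k (fun b => j (Next.old b)) (fun i => (c' (e i)).1) a := by
      simpa only [hc'] using hc
    have hgood : GoodCode C e φ c' := ⟨N, _, _, a, hg, hc'a, ha⟩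
    refine ⟨fun m => j (Next.new ⟨c', hgood⟩ m), ⟨_, fun _ => rfl⟩, ?_⟩
    simpa only [trace_new hj.toPureEmb] using hc'a
  · rintro ⟨y, ⟨r, hr⟩, hc⟩
    obtain ⟨N', _, j', a', hg', hc', ha'⟩ := r.2
    simp only [hr, trace_new hj.toPureEmb] at hc
    -- The code is good by virtue of a tuple in some other generic extension; equal codes give equal
    -- atomic types, and truth transfers.
    exact (Sim.realize_iff hL hg hg' φ hφ
      (hc.sim hg.toPureEmb hg'.toPureEmb hc')).2 ha'

end Next

/-! ### Uniform first-order definability and its closure properties. -/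

section FirstOrderDefinability

variable {L : FirstOrder.Language.{u, v}} {α : Type*}

variable (L) in
/-- A property of tuples that is defined by the same first-order formula in all structures. -/
def FODef {α : Type*} (Φ : ∀ (N : Type w) [(addP L).Structure N], (α → N) → Prop) : Prop :=
  ∃ ψ : (addP L).Formula α, ∀ (N : Type w) [(addP L).Structure N] (a : α → N),
    ψ.Realize a ↔ Φ N a

namespace FODef

variable {Φ Ψ : ∀ (N : Type w) [(addP L).Structure N], (α → N) → Prop}

theorem congr (h : FODef L Φ)
    (hi : ∀ (N : Type w) [(addP L).Structure N] (a : α → N), Φ N a ↔ Ψ N a) : FODef L Ψ :=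
  h.imp fun _ hψ N _ a => (hψ N a).trans (hi N a)

theorem not (h : FODef L Φ) : FODef L fun N _ a => ¬ Φ N a := by
  obtain ⟨ψ, hψ⟩ := h
  exact ⟨ψ.not, fun N _ a => by rw [FirstOrder.Language.Formula.realize_not, hψ]⟩

theorem and (h : FODef L Φ) (h' : FODef L Ψ) : FODef L fun N _ a => Φ N a ∧ Ψ N a := by
  obtain ⟨ψ, hψ⟩ := h
  obtain ⟨ψ', hψ'⟩ := h'
  exact ⟨ψ ⊓ ψ', fun N _ a => by rw [FirstOrder.Language.Formula.realize_inf, hψ, hψ']⟩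

theorem or (h : FODef L Φ) (h' : FODef L Ψ) : FODef L fun N _ a => Φ N a ∨ Ψ N a :=
  (h.not.and h'.not).not.congr fun N _ a => by tauto

theorem imp (h : FODef L Φ) (h' : FODef L Ψ) : FODef L fun N _ a => Φ N a → Ψ N a :=
  (h.and h'.not).not.congr fun N _ a => by tauto

theorem iff (h : FODef L Φ) (h' : FODef L Ψ) : FODef L fun N _ a => (Φ N a ↔ Ψ N a) :=
  ((h.imp h').and (h'.imp h)).congr fun N _ a => by tauto

theorem const (p : Prop) : FODef L (α := α) fun (_ : Type w) _ _ => p := by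
  by_cases hp : p
  · exact ⟨⊤, fun N _ a => by simp [hp]⟩
  · exact ⟨⊥, fun N _ a => by simp [hp]⟩

theorem forall_finite {ι : Type*} [Finite ι]
    {Φ : ι → ∀ (N : Type w) [(addP L).Structure N], (α → N) → Prop} (h : ∀ i, FODef L (Φ i)) :
    FODef L fun N _ a => ∀ i, Φ i N a := by
  choose ψ hψ using h
  exact ⟨FirstOrder.Language.Formula.iInf ψ, fun N _ a => by
    rw [FirstOrder.Language.Formula.realize_iInf]; exact forall_congr' fun i => hψ i N a⟩

theorem exists_finite {ι : Type*} [Finite ι]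
    {Φ : ι → ∀ (N : Type w) [(addP L).Structure N], (α → N) → Prop} (h : ∀ i, FODef L (Φ i)) :
    FODef L fun N _ a => ∃ i, Φ i N a :=
  (forall_finite fun i => (h i).not).not.congr fun N _ a => by simp

theorem relabel {β : Type*} (h : FODef L Φ) (f : α → β) :
    FODef L fun _ _ (b : β → _) => Φ _ fun x => b (f x) := by
  obtain ⟨ψ, hψ⟩ := h
  exact ⟨FirstOrder.Language.Formula.relabel f ψ, fun N _ a => by
    rw [FirstOrder.Language.Formula.realize_relabel, hψ]; rfl⟩

theorem exists_fun {β : Type*} [Finite β]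
    {Φ : ∀ (N : Type w) [(addP L).Structure N], (α → N) → (β → N) → Prop}
    (h : FODef L fun N _ (c : α ⊕ β → N) => Φ N (fun x => c (Sum.inl x)) fun y => c (Sum.inr y)) :
    FODef L fun N _ a => ∃ b : β → N, Φ N a b := by
  obtain ⟨ψ, hψ⟩ := h
  refine ⟨FirstOrder.Language.Formula.iExs β ψ, fun N _ a => ?_⟩
  rw [FirstOrder.Language.Formula.realize_iExs]
  exact exists_congr fun b => hψ N _

theorem exists_elem {Φ : ∀ (N : Type w) [(addP L).Structure N], (α → N) → N → Prop}
    (h : FODef L fun N _ (c : α ⊕ Unit → N) => Φ N (fun x => c (Sum.inl x)) (c (Sum.inr ()))) :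
    FODef L fun N _ a => ∃ z, Φ N a z :=
  (exists_fun (Φ := fun N _ a (b : Unit → N) => Φ N a (b ())) h).congr fun _ _ _ =>
    ⟨fun ⟨b, hb⟩ => ⟨b (), hb⟩, fun ⟨z, hz⟩ => ⟨fun _ => z, hz⟩⟩

theorem forall_elem {Φ : ∀ (N : Type w) [(addP L).Structure N], (α → N) → N → Prop}
    (h : FODef L fun N _ (c : α ⊕ Unit → N) => Φ N (fun x => c (Sum.inl x)) (c (Sum.inr ()))) :
    FODef L fun N _ a => ∀ z, Φ N a z :=
  (exists_elem (Φ := fun N _ a z => ¬ Φ N a z) h.not).not.congr fun N _ a => by simp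

theorem rel {n : ℕ} (R : (addP L).Relations n) (x : Fin n → α) :
    FODef L fun (N : Type w) _ a =>
      FirstOrder.Language.Structure.RelMap R fun i => (a (x i) : N) :=
  ⟨R.formula fun i => FirstOrder.Language.Term.var (x i), fun N _ a => by
    rw [FirstOrder.Language.Formula.realize_rel]; rfl⟩

theorem edge (x y : α) : FODef L fun (N : Type w) _ a => Edge L (a x) (a y : N) :=
  (rel (Sum.inr PRel.P : (addP L).Relations 2) ![x, y]).congr fun N _ a => by
    rw [Edge]
    refine iff_of_eq (congrArg _ (funext fun m => ?_))
    fin_cases m <;> rfl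

theorem eq (x y : α) : FODef L fun (N : Type w) _ a => (a x : N) = a y :=
  ⟨FirstOrder.Language.Term.equal (FirstOrder.Language.Term.var x)
    (FirstOrder.Language.Term.var y), fun N _ a => by
    rw [FirstOrder.Language.Formula.realize_equal]; rfl⟩

theorem eq_const (f : (addP L).Functions 0) (x : α) : FODef L fun (N : Type w) _ a =>
    (a x : N) = FirstOrder.Language.Structure.funMap f (Fin.elim0 : Fin 0 → N) :=
  ⟨FirstOrder.Language.Term.equal (FirstOrder.Language.Term.var x)
    (FirstOrder.Language.Term.func f Fin.elim0), fun N _ a => by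
    rw [FirstOrder.Language.Formula.realize_equal, FirstOrder.Language.Term.realize_func,
      Subsingleton.elim (fun i : Fin 0 => _) (Fin.elim0 : Fin 0 → N)]
    rfl⟩

end FODef

/-! ### First-order definitions of stages and of decoding. -/

section Reading

variable (L)

/-- The elements outside `I` at the positions of `y` code the first `k` values of `a`. -/
def ReadCode {N : Type w} [(addP L).Structure N] (I : N → Prop) (k : ℕ) (y : CodeIdx k → N)
    (a : ℕ → N) : Prop :=
  (∀ l : Fin k, ∀ z, I z →
    (Edge L z (y (Sum.inl l)) ↔ I (a l) ∧ z = a l ∨ ¬ I (a l) ∧ Edge L z (a l)) ∧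
    (Edge L (y (Sum.inl l)) z ↔ I (a l) ∧ z = a l ∨ ¬ I (a l) ∧ Edge L (a l) z)) ∧
  (∀ l : Fin k, (∃ z, I z ∧ Edge L z (y (Sum.inr (Sum.inl l)))) ↔ I (a l)) ∧
  (∀ q : Fin k × Fin k,
    (∃ z, I z ∧ Edge L z (y (Sum.inr (Sum.inr (Sum.inl q))))) ↔ a q.1 = a q.2) ∧
  (∀ q : Fin k × Fin k,
    (∃ z, I z ∧ Edge L z (y (Sum.inr (Sum.inr (Sum.inr q))))) ↔ Edge L (a q.1) (a q.2))

/-- Removes the embedding from the notion of code: only membership in its image remains, which is a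
definable property of elements of `N`. -/
theorem codes_trace_iff {B N : Type w} [(addP L).Structure N] {k : ℕ} (j : B → N)
    (y : CodeIdx k → N) (a : ℕ → N) :
    Codes L k j (fun i => trace L j (y i)) a ↔ ReadCode L (fun x => x ∈ Set.range j) k y a := by
  constructor
  · rintro ⟨h1, h2, h3, h4⟩
    refine ⟨fun l z hz => ?_, fun l => ?_, fun q => ?_, fun q => ?_⟩
    · obtain ⟨b, rfl⟩ := hz
      have := congrFun (h1 l) b
      simp only [trace, edgeType, codeTrace, Prod.mk.injEq, eq_iff_iff] at this
      exact this
    · simpa [trace, edgeType] using h2 l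
    · rw [← h3]; simp [trace, edgeType]
    · rw [← h4]; simp [trace, edgeType]
  · rintro ⟨h1, h2, h3, h4⟩
    refine ⟨fun l => funext fun b => ?_, fun l => ?_, fun l l' => ?_, fun l l' => ?_⟩
    · simp only [trace, edgeType, codeTrace, Prod.mk.injEq, eq_iff_iff]
      exact h1 l _ ⟨b, rfl⟩
    · simpa [trace, edgeType] using h2 l
    · rw [← h3 (l, l')]; simp [trace, edgeType]
    · rw [← h4 (l, l')]; simp [trace, edgeType]

/-- Some maximal tournament outside `I` codes the first `k` values of `a`. -/
def Decoded {N : Type w} [(addP L).Structure N] (I : N → Prop) {k K : ℕ}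
    (e : CodeIdx k ↪ Fin K) (a : ℕ → N) : Prop :=
  ∃ y : Fin K → N, MaxTour L I y ∧ ReadCode L I k (fun i => y (e i)) a

/-- The elements of the `n`-th stage, if tournaments of size `K i` are added at stage `i`. -/
def Inner (K : ℕ → ℕ) {N : Type w} [(addP L).Structure N] : ℕ → N → Prop
  | 0, x => Edge L x x
  | n + 1, x => Inner K n x ∨ ∃ y : Fin (K n) → N, MaxTour L (Inner K n) y ∧ ∃ m, x = y m

variable {L}

theorem FODef.maxTour {I : ∀ (N : Type w) [(addP L).Structure N], N → Prop}
    (hI : ∀ {γ : Type} (x : γ), FODef L fun N _ a => I N (a x)) {α : Type} {K : ℕ}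
    (y : Fin K → α) : FODef L fun N _ a => MaxTour L (I N) fun m => a (y m) := by
  refine (forall_finite fun m => (hI (y m)).not).and
    ((forall_finite fun m => forall_finite fun m' => (edge _ _).iff (const _)).and ?_)
  refine forall_elem (Φ := fun N _ a z => ¬ I N z → ∃ m, ¬ Edge L (a (y m)) z ∧
    ¬ Edge L z (a (y m))) ?_
  exact (hI _).not.imp (exists_finite fun m => (edge _ _).not.and (edge _ _).not)

theorem FODef.decoded {I : ∀ (N : Type w) [(addP L).Structure N], N → Prop}
    (hI : ∀ {γ : Type} (x : γ), FODef L fun N _ a => I N (a x)) {k K : ℕ}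
    (e : CodeIdx k ↪ Fin K) : FODef L fun N _ a => Decoded L (I N) e a := by
  refine exists_fun (Φ := fun N _ a y => MaxTour L (I N) y ∧
    ReadCode L (I N) k (fun i => y (e i)) a) ?_
  have hbit : ∀ x : ℕ ⊕ Fin K, FODef L fun N _ a => ∃ z, I N z ∧ Edge L z (a x) := fun x =>
    exists_elem (Φ := fun N _ a z => I N z ∧ Edge L z (a x)) ((hI _).and (edge _ _))
  refine (maxTour hI _).and (and ?_ (and ?_ (and ?_ ?_)))
  · refine forall_finite fun l => ?_
    refine forall_elem (Φ := fun N _ a z => I N z →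
      (Edge L z (a (Sum.inr (e (Sum.inl l)))) ↔ I N (a (Sum.inl l.1)) ∧ z = a (Sum.inl l.1) ∨
        ¬ I N (a (Sum.inl l.1)) ∧ Edge L z (a (Sum.inl l.1))) ∧
      (Edge L (a (Sum.inr (e (Sum.inl l)))) z ↔ I N (a (Sum.inl l.1)) ∧ z = a (Sum.inl l.1) ∨
        ¬ I N (a (Sum.inl l.1)) ∧ Edge L (a (Sum.inl l.1)) z)) ?_
    exact (hI _).imp
      (((edge _ _).iff (((hI _).and (eq _ _)).or ((hI _).not.and (edge _ _)))).and
        ((edge _ _).iff (((hI _).and (eq _ _)).or ((hI _).not.and (edge _ _)))))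
  · exact forall_finite fun l => (hbit _).iff (hI _)
  · exact forall_finite fun q => (hbit _).iff (eq _ _)
  · exact forall_finite fun q => (hbit _).iff (edge _ _)

/-- The variable type is kept arbitrary because the induction step applies the previous stage to
freshly quantified variables. -/
theorem FODef.inner (K : ℕ → ℕ) (n : ℕ) :
    ∀ {γ : Type} (x : γ), FODef L fun (N : Type w) _ a => Inner L K n (a x : N) := by
  induction n with
  | zero => exact fun x => edge x x
  | succ n ih =>
    intro γ x
    refine (ih x).or (exists_fun (Φ := fun N _ a (y : Fin (K n) → N) =>
      MaxTour L (Inner L K n) y ∧ ∃ m, a x = y m) ?_)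
    exact (maxTour ih _).and (exists_finite fun m => eq _ _)

end Reading

end FirstOrderDefinability

/-! ### Invariance under isomorphism, and absorbing finite structures. -/

section Isomorphism

variable {L : FirstOrder.Language.{u, v}} {N M : Type w} [(addP L).Structure N]
  [(addP L).Structure M]

theorem edge_equiv (f : N ≃[addP L] M) (x y : N) : Edge L (f x) (f y) ↔ Edge L x y := by
  have h := f.map_rel (Sum.inr PRel.P : (addP L).Relations 2) ![x, y]
  rw [show f ∘ ![x, y] = ![f x, f y] by funext m; fin_cases m <;> rfl] at h
  exact h

theorem pureEmb_equiv (f : N ≃[addP L] M) : PureEmb L f where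
  inj := f.injective
  edge := edge_equiv f
  rel R xs := by
    constructor
    · intro h
      refine ⟨fun i => f.symm (xs i), funext fun i => f.apply_symm_apply _, ?_⟩
      refine (f.map_rel (Sum.inl R : (addP L).Relations _) _).1 ?_
      convert h using 1
      exact funext fun i => f.apply_symm_apply _
    · rintro ⟨ys, rfl, h⟩
      exact (f.map_rel _ _).2 h
  const g xs ys := by
    rw [f.map_fun]
    congr 1
    exact Subsingleton.elim _ _
  loopless x hx := (hx (f.surjective x)).elim

/-- An isomorphism leaves no outer elements, so it is trivially generic without any traces.
Invariance of infinitary formulas thus becomes a case of `Sim.realize_iff`. -/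
theorem gen_equiv (f : N ≃[addP L] M) (k : ℕ) : Gen L ∅ k f :=
  { pureEmb_equiv f with
    trace_mem := fun x hx => (hx (f.surjective x)).elim
    ext := fun _ _ _ _ hc => hc.elim }

theorem realize_equiv (hL : IsVocabulary L) (f : N ≃[addP L] M)
    (φ : InfFormula.{u, v, i} (addP L)) {k : ℕ} (hφ : ∀ x ∈ φ.vars, x < k) {a : ℕ → N}
    {a' : ℕ → M} (h : ∀ l : Fin k, a' l = f (a l)) : φ.Realize a ↔ φ.Realize a' := by
  refine Sim.realize_iff hL (gen_equiv (FirstOrder.Language.Equiv.refl (addP L) N) k)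
    (gen_equiv f k) φ hφ ?_
  have hv : ∀ u : Fin k ⊕ N, val k f a' u =
      f (val k (FirstOrder.Language.Equiv.refl (addP L) N) a u) := by
    rintro (l | b)
    · exact h l
    · rfl
  intro u u'
  rw [hv, hv, f.injective.eq_iff, edge_equiv]
  exact ⟨Iff.rfl, Iff.rfl⟩

variable (N) in
/-- A finite structure of a finite vocabulary, together with a set of `k`-tuples, is defined up to
isomorphism by a first-order formula. -/
theorem FODef.equiv (hL : IsVocabulary L) [Finite N] (k : ℕ) (T : (Fin k → N) → Prop) :
    FODef L fun (M : Type w) _ (a : ℕ → M) =>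
      ∃ f : N ≃[addP L] M, ∃ t, T t ∧ ∀ l : Fin k, a l = f (t l) := by
  have hsym := hL.finite_symbols
  have hR : Finite (Σ n, L.Relations n) :=
    Finite.of_injective (fun x => (Sum.inr x : L.Symbols)) Sum.inr_injective
  have hF : Finite (Σ n, L.Functions n) :=
    Finite.of_injective (fun x => (Sum.inl x : L.Symbols)) Sum.inl_injective
  have hF0 : Finite (L.Functions 0) :=
    Finite.of_injective (fun x => (⟨0, x⟩ : Σ n, L.Functions n)) sigma_mk_injective
  have hF0' : Finite ((addP L).Functions 0) :=
    inferInstanceAs (Finite (L.Functions 0 ⊕ Empty))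
  -- The formula is the diagram of `N`, with one quantified variable for each element and a clause
  -- that there are no others; `T` becomes a finite disjunction.
  refine FODef.congr (L := L) (Φ := fun M _ (a : ℕ → M) => ∃ y : N → M, (∀ p q, y p = y q → p = q) ∧
    (∀ z, ∃ p, z = y p) ∧
    (∀ (R : Σ n, L.Relations n) (v : Fin R.1 → N),
      FirstOrder.Language.Structure.RelMap (L := addP L) (Sum.inl R.2 : (addP L).Relations R.1)
        (fun i => y (v i)) ↔
      FirstOrder.Language.Structure.RelMap (L := addP L) (Sum.inl R.2 : (addP L).Relations R.1) v) ∧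
    (∀ p q : N, Edge L (y p) (y q) ↔ Edge L p q) ∧
    (∀ g : (addP L).Functions 0,
      y (FirstOrder.Language.Structure.funMap g Fin.elim0) =
        FirstOrder.Language.Structure.funMap g Fin.elim0) ∧
    ∃ t, T t ∧ ∀ l : Fin k, a l = y (t l)) ?_ ?_
  · refine FODef.exists_fun (L := L) (β := N) (Φ := fun M _ (a : ℕ → M) y => (∀ p q, y p = y q → p = q) ∧
      (∀ z, ∃ p, z = y p) ∧
      (∀ (R : Σ n, L.Relations n) (v : Fin R.1 → N),
        FirstOrder.Language.Structure.RelMap (L := addP L) (Sum.inl R.2 : (addP L).Relations R.1)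
          (fun i => y (v i)) ↔
        FirstOrder.Language.Structure.RelMap (L := addP L) (Sum.inl R.2 : (addP L).Relations R.1) v) ∧
      (∀ p q : N, Edge L (y p) (y q) ↔ Edge L p q) ∧
      (∀ g : (addP L).Functions 0,
        y (FirstOrder.Language.Structure.funMap g Fin.elim0) =
          FirstOrder.Language.Structure.funMap g Fin.elim0) ∧
      ∃ t, T t ∧ ∀ l : Fin k, a l = y (t l)) ?_
    refine .and ?_ (.and ?_ (.and ?_ (.and ?_ (.and ?_ ?_))))
    · exact .forall_finite fun p => .forall_finite fun q => .imp (.eq _ _) (.const _)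
    · exact .forall_elem (Φ := fun M _ a z => ∃ p : N, z = a (Sum.inr p))
        (.exists_finite fun p => .eq _ _)
    · exact .forall_finite fun R => .forall_finite fun v => .iff
        (.rel (Sum.inl R.2 : (addP L).Relations R.1) fun i => Sum.inr (v i)) (.const _)
    · exact .forall_finite fun p => .forall_finite fun q => .iff (.edge _ _) (.const _)
    · exact .forall_finite fun g => .eq_const _ _
    · exact .exists_finite fun t => .and (.const _) (.forall_finite fun l => .eq _ _)
  · intro M _ a
    constructor
    · rintro ⟨y, hinj, hsurj, hrel, hedge, hconst, t, ht, ha⟩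
      let f : N ≃[addP L] M :=
        { Equiv.ofBijective y ⟨fun p q h => hinj p q h, fun z => (hsurj z).imp fun _ h => h.symm⟩ with
          map_fun' := by
            rintro n g xs
            rcases n with _ | n
            · rw [Subsingleton.elim xs Fin.elim0, Subsingleton.elim (_ ∘ _) Fin.elim0]
              exact hconst g
            · rcases g with g | g
              · exact ((hL.no_functions _ n.succ_pos).false g).elim
              · exact g.elim
          map_rel' := by
            rintro n R xs
            rcases R with R | R
            · exact hrel ⟨n, R⟩ xs
            · obtain ⟨rfl, rfl⟩ := langP_relation R
              have h := hedge (xs 0) (xs 1)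
              rw [Edge, Edge] at h
              convert h using 2 <;> (funext m; fin_cases m <;> rfl) }
      exact ⟨f, t, ht, ha⟩
    · rintro ⟨f, t, ht, ha⟩
      refine ⟨f, fun p q h => f.injective h, fun z => ⟨f.symm z, (f.apply_symm_apply z).symm⟩,
        fun R v => f.map_rel _ _, edge_equiv f, fun g => ?_, t, ht, ha⟩
      rw [f.map_fun]
      congr 1
      exact Subsingleton.elim _ _

/-- First-order definability is not affected by finitely many finite structures. -/
theorem exists_formula_union (hL : IsVocabulary L) [Finite N]
    (φ : InfFormula.{u, v, i} (addP L)) {k : ℕ} (hφ : ∀ x ∈ φ.vars, x < k)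
    (K : Set (Bundled.{w} (addP L).Structure)) (h : ∃ ψ : (addP L).Formula ℕ, φ.EquivIn K ψ) :
    ∃ ψ : (addP L).Formula ℕ,
      φ.EquivIn (K ∪ {M | Nonempty (N ≃[addP L] M)}) ψ := by
  obtain ⟨ψ, hψ⟩ := h
  -- Definition by cases: on copies of `N` the satisfying tuples are listed outright, elsewhere `ψ`
  -- is used.
  obtain ⟨χ, hχ⟩ := ((FODef.equiv N hL k fun t =>
      ∃ a : ℕ → N, (∀ l : Fin k, a l = t l) ∧ φ.Realize a).or
    ((FODef.equiv N hL k fun _ => True).not.and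
      (⟨ψ, fun M _ a => Iff.rfl⟩ : FODef L fun (M : Type w) _ a => ψ.Realize a)))
  refine ⟨χ, fun M hM a => ?_⟩
  rw [hχ]
  by_cases hN : Nonempty (N ≃[addP L] M)
  · obtain ⟨f⟩ := hN
    have h1 : ∃ f : N ≃[addP L] M, ∃ t : Fin k → N, True ∧ ∀ l : Fin k, a l = f (t l) :=
      ⟨f, fun l => f.symm (a l), trivial, fun l => (f.apply_symm_apply _).symm⟩
    simp only [h1, not_true_eq_false, false_and, or_false]
    constructor
    · intro ha
      refine ⟨f, fun l => f.symm (a l), ⟨fun x => f.symm (a x), fun _ => rfl, ?_⟩,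
        fun l => (f.apply_symm_apply _).symm⟩
      exact (realize_equiv hL f φ hφ fun l => (f.apply_symm_apply _).symm).2 ha
    · rintro ⟨f, t, ⟨a₀, h₀, ha₀⟩, ht⟩
      exact (realize_equiv hL f φ hφ fun l => by rw [ht, h₀]).1 ha₀
  · have h1 : ∀ T : (Fin k → N) → Prop,
        ¬ ∃ f : N ≃[addP L] M, ∃ t : Fin k → N, T t ∧ ∀ l : Fin k, a l = f (t l) :=
      fun T ⟨f, _⟩ => hN ⟨f⟩
    simp only [h1, not_false_eq_true, false_or]
    rw [true_and]
    exact hψ M (hM.resolve_right hN) a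

end Isomorphism

/-! ### Iterating the coding step. -/

section Stages

variable (L : FirstOrder.Language.{u, v})

/-- A finite structure with a set of admissible traces. -/
structure Stage where
  carrier : Type w
  [str : (addP L).Structure carrier]
  [finite : Finite carrier]
  [nonempty : Nonempty carrier]
  colors : Set (carrier → Prop × Prop)
  rich : Rich colors

attribute [instance] Stage.str Stage.finite Stage.nonempty

/-- A formula whose truth is to be coded by tournaments of size `size`. -/
structure CodingTask where
  formula : InfFormula.{u, v, i} (addP L)
  width : ℕ
  size : ℕ
  emb : CodeIdx width ↪ Fin size
  vars_lt : ∀ x ∈ formula.vars, x < width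
  width_le : width ≤ size
  two_le : 2 ≤ size

variable {L}

/-- The stage in which the truth of a formula has been coded. -/
def Stage.next (s : Stage.{u, v, w} L) (r : CodingTask.{u, v, i} L) : Stage.{u, v, w} L where
  carrier := Next s.colors r.emb r.formula
  nonempty := s.nonempty.map Next.old
  colors := nextColors s.colors r.emb r.formula
  rich := nextColors_rich s.rich r.two_le

/-- The stages in which a sequence of formulas is coded. -/
def Stage.iter (s : Stage.{u, v, w} L) (r : ℕ → CodingTask.{u, v, i} L) : ℕ → Stage.{u, v, w} L
  | 0 => s
  | n + 1 => (s.iter r n).next (r n)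

/-- A generic extension of a late stage is generic over every earlier one, by repeated use of
`Gen.old`. Genericity over the `n`-th stage then drops to the size of the `n`-th tournaments, so the
sizes have to increase strictly. The loops of `P` single out the initial stage and start the
recursive definition. -/
theorem Stage.iter_spec (hL : IsVocabulary L) (s : Stage.{u, v, w} L)
    (hs : ∀ b : s.carrier, Edge L b b) (r : ℕ → CodingTask.{u, v, i} L)
    (hr : StrictMono fun n => (r n).size) (n : ℕ) {N : Type w} [(addP L).Structure N] :
    ∀ {κ : ℕ} {j : (s.iter r n).carrier → N}, Gen L (s.iter r n).colors κ j →
      (∀ i < n, (r i).size < κ) →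
      (∀ x, Inner L (fun n => (r n).size) n x ↔ x ∈ Set.range j) ∧
      (∃ j₀ : s.carrier → N, PureEmb L j₀ ∧ ∀ x, Edge L x x ↔ x ∈ Set.range j₀) ∧
      ∀ i < n, ∀ a : ℕ → N, (r i).formula.Realize a ↔
        Decoded L (Inner L (fun n => (r n).size) i) (r i).emb a := by
  induction n with
  | zero =>
    intro κ j hj _
    have h : ∀ x, Edge L x x ↔ x ∈ Set.range j := by
      intro x
      refine ⟨fun h => by_contra fun hx => hj.loopless x hx h, ?_⟩
      rintro ⟨b, rfl⟩
      exact (hj.edge b b).2 (hs b)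
    exact ⟨h, ⟨j, hj.toPureEmb, h⟩, fun i hi => absurd hi (Nat.not_lt_zero i)⟩
  | succ n ih =>
    intro κ j hj hκ
    have hn := hκ n n.lt_succ_self
    have hpos : 0 < (r n).size := two_pos.trans_le (r n).two_le
    change Gen L (nextColors (s.iter r n).colors (r n).emb (r n).formula) κ j at hj
    obtain ⟨h1, h2, h3⟩ := ih (hj.old hn.le) fun i hi => hr hi
    have hI : Inner L (fun n => (r n).size) n =
        fun x => x ∈ Set.range fun b => j (Next.old b) := funext fun x => propext (h1 x)
    refine ⟨fun x => ?_, h2, fun i hi a => ?_⟩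
    · rw [Inner, hI]
      exact (mem_range_next_iff (s.iter r n).rich hj hn x).symm
    · rcases Nat.lt_succ_iff_lt_or_eq.1 hi with hi | rfl
      · exact h3 i hi a
      · rw [Decoded, hI]
        simp only [← codes_trace_iff]
        exact realize_iff_exists_maxTour hL (s.iter r i).rich hj (r i).width_le hn
          (r i).vars_lt a

/-- Every structure extends to structures in which the first `n` of a sequence of formulas are
decoded by first-order formulas. -/
theorem exists_decoding_extension (hL : IsVocabulary L) {M : Type w} [L.Structure M] [Finite M]
    [Nonempty M] (r : ℕ → CodingTask.{u, v, i} L) (hr : StrictMono fun n => (r n).size) (n : ℕ) :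
    ∃ (N : Type w) (_ : (addP L).Structure N), Finite N ∧
      (∃ j : M → N, Function.Injective j ∧ (∀ x, Edge L x x ↔ x ∈ Set.range j) ∧
        (∀ (m : ℕ) (R : L.Relations m) (xs : Fin m → M),
          FirstOrder.Language.Structure.RelMap (L := addP L) (Sum.inl R : (addP L).Relations m)
            (fun i => j (xs i)) ↔ FirstOrder.Language.Structure.RelMap R xs) ∧
        ∀ (f : L.Functions 0) (xs : Fin 0 → M) (ys : Fin 0 → N),
          FirstOrder.Language.Structure.funMap (L := addP L) (Sum.inl f : (addP L).Functions 0) ys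
            = j (FirstOrder.Language.Structure.funMap f xs)) ∧
      ∀ i < n, ∀ a : ℕ → N, (r i).formula.Realize a ↔
        Decoded L (Inner L (fun n => (r n).size) i) (r i).emb a := by
  let str : (addP L).Structure M :=
    { funMap := fun {m} f xs => match m, f, xs with
        | _, Sum.inl f, xs => FirstOrder.Language.Structure.funMap f xs
        | _, Sum.inr f, _ => f.elim
      RelMap := fun {m} R xs => match m, R, xs with
        | _, Sum.inl R, xs => FirstOrder.Language.Structure.RelMap R xs
        | _, Sum.inr PRel.P, xs => xs 0 = xs 1 }
  -- Initially `P` is equality, so that the loops mark `M`, and all traces are allowed.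
  let s : Stage L := ⟨M, Set.univ, trivial, fun _ => trivial⟩
  obtain ⟨N, strN, j, hfin, hj⟩ := exists_gen (L := L) (s.iter r n).colors (r n).size
  obtain ⟨-, ⟨j₀, hj₀, hrange⟩, hdec⟩ :=
    Stage.iter_spec hL s (fun b => rfl) r hr n hj fun i hi => hr hi
  refine ⟨N, strN, hfin, ⟨j₀, hj₀.inj, hrange, fun m R xs => ?_, fun f xs ys => ?_⟩, hdec⟩
  · rw [hj₀.rel]
    constructor
    · rintro ⟨ys, hys, h⟩
      have : ys = xs := funext fun i => hj₀.inj (congrFun hys i)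
      exact this ▸ h
    · exact fun h => ⟨xs, rfl, h⟩
  · exact hj₀.const (Sum.inl f) xs ys

end Stages

/-! ### Enumerating the class and the formulas. -/

section Enumeration

variable {L : FirstOrder.Language.{u, v}}

theorem countable_structure (hL : IsVocabulary L) (m : ℕ) : Countable (L.Structure (Fin m)) := by
  have hsym := hL.finite_symbols
  have hR : Finite (Σ n, L.Relations n) :=
    Finite.of_injective (fun x => (Sum.inr x : L.Symbols)) Sum.inr_injective
  have hF : Finite (Σ n, L.Functions n) :=
    Finite.of_injective (fun x => (Sum.inl x : L.Symbols)) Sum.inl_injective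
  let F : L.Structure (Fin m) →
      ((f : Σ n, L.Functions n) → (Fin f.1 → Fin m) → Fin m) ×
        ((R : Σ n, L.Relations n) → (Fin R.1 → Fin m) → Prop) :=
    fun s => (fun f => s.funMap f.2, fun R => s.RelMap R.2)
  have hF : Function.Injective F := by
    intro s s' h
    have h1 := congrArg Prod.fst h
    have h2 := congrArg Prod.snd h
    ext n f xs
    · exact congrArg Fin.val (congrFun (congrFun h1 ⟨n, f⟩) xs)
    · exact iff_of_eq (congrFun (congrFun h2 ⟨n, f⟩) xs)
  have := Finite.of_injective F hF
  infer_instance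

/-- A class of finite structures of a finite vocabulary is countable up to isomorphism. -/
theorem exists_enumeration (hL : IsVocabulary L) {K : Set (Bundled.{w} L.Structure)}
    (hK : IsClass K) (hne : K.Nonempty) :
    ∃ f : ℕ → Bundled.{w} L.Structure, (∀ n, f n ∈ K) ∧ ∀ M ∈ K, ∃ n, Nonempty (f n ≃[L] M) := by
  have := countable_structure hL
  let T : Set (Σ m, L.Structure (Fin m)) :=
    {t | ∃ M ∈ K, letI := t.2; Nonempty (M ≃[L] Fin t.1)}
  have hT : ∀ M ∈ K, ∃ t ∈ T, letI := t.2; Nonempty (M ≃[L] Fin t.1) := by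
    intro M hM
    have := hK.finite M hM
    let e := Finite.equivFin M
    have h : letI := e.inducedStructure (L := L); Nonempty (M ≃[L] Fin (Nat.card M)) :=
      ⟨e.inducedStructureEquiv⟩
    exact ⟨⟨_, e.inducedStructure⟩, ⟨M, hM, h⟩, h⟩
  obtain ⟨M₀, hM₀⟩ := hne
  obtain ⟨t₀, ht₀, -⟩ := hT M₀ hM₀
  obtain ⟨g, hg⟩ := T.to_countable.exists_eq_range ⟨t₀, ht₀⟩
  have hgT : ∀ n, g n ∈ T := fun n => hg ▸ ⟨n, rfl⟩
  choose f hf hfg using hgT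
  refine ⟨f, hf, fun M hM => ?_⟩
  obtain ⟨t, ht, ⟨e⟩⟩ := hT M hM
  rw [hg] at ht
  obtain ⟨n, rfl⟩ := ht
  obtain ⟨e'⟩ := hfg n
  let := (g n).2
  exact ⟨n, ⟨e.symm.comp e'⟩⟩

/-- The formulas of a countable set can be arranged in a sequence of tasks. -/
theorem exists_tasks {𝓛 : Set (InfFormula.{u, v, i} (addP L))} (h𝓛 : 𝓛 ⊆ finVarLogic (addP L))
    (hc : 𝓛.Countable) :
    ∃ r : ℕ → CodingTask.{u, v, i} L, (StrictMono fun n => (r n).size) ∧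
      ∀ φ ∈ 𝓛, ∃ n, (r n).formula = φ := by
  let φ₀ : InfFormula.{u, v, i} (addP L) := .conj (I := PEmpty) PEmpty.elim
  have hφ₀ : φ₀ ∈ finVarLogic (addP L) := by
    have : φ₀.vars = ∅ := Set.iUnion_of_empty _
    change φ₀.vars.Finite
    rw [this]
    exact Set.finite_empty
  -- The empty conjunction is added so that there is something to enumerate even if `𝓛` is empty.
  obtain ⟨f, hf⟩ := (hc.insert φ₀).exists_eq_range ⟨φ₀, Set.mem_insert _ _⟩
  have hfin : ∀ n, (f n).vars.Finite := by
    intro n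
    have : f n ∈ insert φ₀ 𝓛 := hf ▸ ⟨n, rfl⟩
    rcases this with h | h
    · rw [h]; exact hφ₀
    · exact h𝓛 h
  have hw : ∀ n, ∃ k : ℕ, ∀ x ∈ (f n).vars, x < k := by
    intro n
    obtain ⟨k, hk⟩ := (hfin n).bddAbove
    exact ⟨k + 1, fun x hx => Nat.lt_succ_of_le (hk hx)⟩
  choose k hk using hw
  -- The sum makes room for every code, `n` forces strict growth, and `2` is needed for richness.
  let K : ℕ → ℕ := fun n => n + 2 + ∑ i ∈ Finset.range (n + 1), Fintype.card (CodeIdx (k i))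
  have hK : ∀ n, Fintype.card (CodeIdx (k n)) ≤ K n := fun n =>
    (Finset.single_le_sum (f := fun i => Fintype.card (CodeIdx (k i))) (fun _ _ => Nat.zero_le _)
      (Finset.self_mem_range_succ n)).trans (Nat.le_add_left _ _)
  have he : ∀ n, Nonempty (CodeIdx (k n) ↪ Fin (K n)) := fun n =>
    Function.Embedding.nonempty_of_card_le (by simpa using hK n)
  refine ⟨fun n => ⟨f n, k n, K n, (he n).some, hk n, ?_, ?_⟩, ?_, fun φ hφ => ?_⟩
  · refine le_trans ?_ (hK n)
    simp only [Fintype.card_sum, Fintype.card_fin]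
    omega
  · simp only [K]; omega
  · refine strictMono_nat_of_lt_succ fun n => ?_
    simp only [K]
    rw [Finset.sum_range_succ _ (n + 1)]
    omega
  · have : φ ∈ Set.range f := hf ▸ Set.mem_insert_of_mem _ hφ
    exact this

end Enumeration

/-! ### The reduct to the loops of `P`. -/

section Reducts

variable {L : FirstOrder.Language.{u, v}}

/-- `M` is isomorphic to the reduct of the substructure `{x | P(x, x)}` of `N`. -/
def DiagReduct (M : Type w) [L.Structure M] (N : Type w) [(addP L).Structure N] : Prop :=
  ∃ S : (addP L).Substructure N, (S : Set N) = diagP L N ∧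
    Nonempty (M ≃[L] reductOf (M := ⟨N, inferInstance⟩) S)

theorem DiagReduct.of_embedding (hL : IsVocabulary L) {M N : Type w} [L.Structure M]
    [(addP L).Structure N] (j : M → N) (hj : Function.Injective j)
    (hdiag : ∀ x, Edge L x x ↔ x ∈ Set.range j)
    (hrel : ∀ (m : ℕ) (R : L.Relations m) (xs : Fin m → M),
      FirstOrder.Language.Structure.RelMap (L := addP L) (Sum.inl R : (addP L).Relations m)
        (fun i => j (xs i)) ↔ FirstOrder.Language.Structure.RelMap R xs)
    (hfun : ∀ (f : L.Functions 0) (xs : Fin 0 → M) (ys : Fin 0 → N),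
      FirstOrder.Language.Structure.funMap (L := addP L) (Sum.inl f : (addP L).Functions 0) ys
        = j (FirstOrder.Language.Structure.funMap f xs)) :
    DiagReduct (L := L) M N := by
  have hset : Set.range j = diagP L N := Set.ext fun x => (hdiag x).symm
  let S : (addP L).Substructure N :=
    { carrier := Set.range j
      fun_mem := by
        rintro n (f | f) xs -
        · rcases n with _ | n
          · exact ⟨FirstOrder.Language.Structure.funMap f Fin.elim0, (hfun f _ _).symm⟩
          · exact ((hL.no_functions _ n.succ_pos).false f).elim
        · exact f.elim }
  refine ⟨S, hset, ⟨?_⟩⟩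
  refine
    { Equiv.ofInjective j hj with
      map_fun' := ?_
      map_rel' := ?_ }
  · intro n f xs
    rcases n with _ | n
    · exact Subtype.ext (hfun f _ _).symm
    · exact ((hL.no_functions _ n.succ_pos).false f).elim
  · exact fun {n} R xs => hrel n R xs

end Reducts

end McColm

/-! ### Assembling the class. -/

theorem mainTheorem5 (L : FirstOrder.Language.{u, v}) (hL : IsVocabulary L)
    (K₁ : Set (CategoryTheory.Bundled.{w} L.Structure)) (hK₁ : IsClass K₁)
    (𝓛 : Set (InfFormula.{u, v, i} (addP L))) (h𝓛 : 𝓛 ⊆ finVarLogic (addP L))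
    (h𝓛c : 𝓛.Countable) :
    ∃ K₂ : Set (CategoryTheory.Bundled.{w} (addP L).Structure),
      IsClass K₂ ∧
      -- `{x | P(x, x)}` is the universe of a substructure of each member of `K₂`
      (∀ M₂ ∈ K₂, ∃ S : (addP L).Substructure M₂, (S : Set M₂) = diagP L M₂) ∧
      -- `K₁` consists, up to isomorphism, of the reducts of these substructures
      (∀ M₁ : CategoryTheory.Bundled.{w} L.Structure,
        M₁ ∈ K₁ ↔ ∃ M₂ ∈ K₂, ∃ S : (addP L).Substructure M₂,
          (S : Set M₂) = diagP L M₂ ∧ Nonempty (M₁ ≃[L] reductOf S)) ∧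
      -- every formula in `𝓛` is equivalent to a first-order formula in `K₂`
      (∀ φ ∈ 𝓛, ∃ ψ : (addP L).Formula ℕ, φ.EquivIn K₂ ψ) := by
  rcases K₁.eq_empty_or_nonempty with rfl | hne
  · exact ⟨∅, ⟨fun _ h => h.elim, fun _ h => h.elim, fun _ h => h.elim⟩, fun _ h => h.elim,
      fun _ => ⟨fun h => h.elim, fun ⟨_, h, _⟩ => h.elim⟩, fun _ _ => ⟨⊥, fun _ h => h.elim⟩⟩
  obtain ⟨f, hfK, hf⟩ := exists_enumeration hL hK₁ hne
  obtain ⟨r, hr, hr𝓛⟩ := exists_tasks h𝓛 h𝓛c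
  have hext : ∀ n, _ := fun n =>
    have := hK₁.finite _ (hfK n)
    have := hK₁.nonempty _ (hfK n)
    exists_decoding_extension hL (M := f n) r hr n
  choose N strN hfin hemb hdec using hext
  have hred : ∀ n (M₂ : CategoryTheory.Bundled.{w} (addP L).Structure),
      Nonempty (N n ≃[addP L] M₂) → DiagReduct (L := L) (f n) M₂ := by
    rintro n M₂ ⟨e⟩
    obtain ⟨j, hj, hdiag, hrel, hfun⟩ := hemb n
    refine DiagReduct.of_embedding hL (fun x => e (j x)) (e.injective.comp hj) (fun x => ?_)
      (fun m R xs => ?_) fun g xs ys => ?_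
    · have h := edge_equiv e (e.symm x) (e.symm x)
      rw [e.apply_symm_apply] at h
      rw [h, hdiag]
      exact ⟨fun ⟨b, hb⟩ => ⟨b, (congrArg e hb).trans (e.apply_symm_apply x)⟩,
        fun ⟨b, hb⟩ => ⟨b, (e.symm_apply_apply _).symm.trans (congrArg e.symm hb)⟩⟩
    · exact (e.map_rel (Sum.inl R : (addP L).Relations m) fun i => j (xs i)).trans (hrel m R xs)
    · rw [← hfun g xs Fin.elim0]
      have h := e.map_fun (Sum.inl g : (addP L).Functions 0) Fin.elim0
      rw [Subsingleton.elim (_ ∘ _) ys] at h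
      exact h.symm
  refine ⟨{M₂ | ∃ n, Nonempty (N n ≃[addP L] M₂)}, ⟨?_, ?_, ?_⟩, ?_, fun M₁ => ⟨?_, ?_⟩, ?_⟩
  · rintro M₂ ⟨n, ⟨e⟩⟩
    have := hfin n
    exact Finite.of_equiv _ e.toEquiv
  · rintro M₂ ⟨n, ⟨e⟩⟩
    obtain ⟨x⟩ := hK₁.nonempty _ (hfK n)
    obtain ⟨j, -⟩ := hemb n
    exact ⟨e (j x)⟩
  · rintro M₂ ⟨n, ⟨e⟩⟩ M₃ ⟨e'⟩
    exact ⟨n, ⟨e'.comp e⟩⟩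
  · rintro M₂ ⟨n, he⟩
    obtain ⟨S, hS, -⟩ := hred n M₂ he
    exact ⟨S, hS⟩
  · intro hM₁
    obtain ⟨n, ⟨e⟩⟩ := hf M₁ hM₁
    have h : Nonempty (N n ≃[addP L] (⟨N n, strN n⟩ : Bundled (addP L).Structure)) :=
      ⟨FirstOrder.Language.Equiv.refl _ _⟩
    obtain ⟨S, hS, ⟨e'⟩⟩ := hred n _ h
    exact ⟨_, ⟨n, h⟩, S, hS, ⟨e'.comp e.symm⟩⟩
  · rintro ⟨M₂, ⟨n, he⟩, S, hS, ⟨e⟩⟩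
    obtain ⟨S', hS', ⟨e'⟩⟩ := hred n M₂ he
    -- A substructure is determined by its universe, here the set of loops, so the reduct is the
    -- intended one.
    obtain rfl : S' = S := SetLike.coe_injective (hS'.trans hS.symm)
    exact hK₁.closed_under_iso _ (hfK n) _ ⟨e.symm.comp e'⟩
  · intro φ hφ
    obtain ⟨i, rfl⟩ := hr𝓛 φ hφ
    have hbase : ∃ ψ : (addP L).Formula ℕ, (r i).formula.EquivIn
        {M₂ : Bundled.{w} (addP L).Structure | ∃ n, i < n ∧ Nonempty (N n ≃[addP L] M₂)} ψ := by
      obtain ⟨χ, hχ⟩ := FODef.decoded.{u, v, w} (FODef.inner (L := L) (fun n => (r n).size) i)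
        (r i).emb
      refine ⟨χ, ?_⟩
      rintro M₂ ⟨n, hn, ⟨e⟩⟩ a
      have ha : a = fun x => e (e.symm (a x)) := funext fun x => (e.apply_symm_apply _).symm
      rw [← realize_equiv hL e (r i).formula (r i).vars_lt (a := fun x => e.symm (a x))
        fun l => congrFun ha l, hdec n i hn]
      refine (hχ (N n) _).symm.trans ?_
      conv_rhs => rw [ha]
      exact (FirstOrder.Language.StrongHomClass.realize_formula e χ).symm
    -- The structures with index at most `i`, in which the `i`-th formula need not be decoded, are
    -- added one at a time; `m = i + 1` exhausts the class.
    have hstep : ∀ m, ∃ ψ : (addP L).Formula ℕ, (r i).formula.EquivIn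
        {M₂ : Bundled.{w} (addP L).Structure |
          ∃ n, (i < n ∨ n < m) ∧ Nonempty (N n ≃[addP L] M₂)} ψ := by
      intro m
      induction m with
      | zero => simpa using hbase
      | succ m ih =>
        have := hfin m
        obtain ⟨ψ, hψ⟩ := exists_formula_union (N := N m) hL (r i).formula (r i).vars_lt _ ih
        refine ⟨ψ, fun M₂ hM₂ => hψ M₂ ?_⟩
        obtain ⟨n, hn, he⟩ := hM₂
        by_cases h : n = m
        · subst h
          exact Or.inr he
        · exact Or.inl ⟨n, by omega, he⟩
    obtain ⟨ψ, hψ⟩ := hstep (i + 1)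
    exact ⟨ψ, fun M₂ ⟨n, he⟩ => hψ M₂ ⟨n, by omega, he⟩⟩
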